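/- Let $n\ge 1$, let $M$ be a smooth $n$-dimensional manifold and let $x:M\to\mathbb{R}^{n+1}$ be a centroaffine hypersurface, i.e. a smooth immersion such that for every $p\in M$ the position vector $x(p)$ is transversal to the tangent hyperplane of $x$ at $p$. For $\varepsilon\in\{1,-1\}$, let the induced connection $\nabla$ and the centroaffine metric $h$ be defined by the Gauss formula $$D_X x_*(Y)=x_*(\nabla_XY)+h(X,Y)(-\varepsilon x),$$ where $D$ is the standard flat connection of $\mathbb{R}^{n+1}$. Assume that $x$ is locally strongly convex, i.e. that $h$ is positive definite for one choice of $\varepsilon\in\{1,-1\}$, which we fix. Let $\hat\nabla$ be the Levi-Civita connection of $h$ and $C=\nabla h$ the cubic form, and assume that $x$ is canonical, i.e. that $h$ is flat and $\hat\nabla C=0$. Then $x$ is locally centroaffinely equivalent to one of the following hypersurfaces $H\subset\mathbb{R}^{n+1}$: (i) $x_1^{\alpha_1}x_2^{\alpha_2}\cdots x_{n+1}^{\alpha_{n+1}}=1$ (in the domain $x_i>0$, $1\le i\le n+1$), where the $\alpha_i$ are real numbers such that either $\alpha_i>0$ for $1\le i\le n+1$, or $\alpha_1<0$, $\alpha_i>0$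 for $2\le i\le n+1$ and $\sum_{i=1}^{n+1}\alpha_i<0$; (ii) $x_1^{\alpha_1}\cdots x_{n-1}^{\alpha_{n-1}}\,(x_n^2+x_{n+1}^2)^{\alpha_n}\exp\!\left(\alpha_{n+1}\arctan\frac{x_n}{x_{n+1}}\right)=1$ (in the domain $x_i>0$ for $1\le i\le n-1$, $x_{n+1}\neq0$), where the $\alpha_i$ are real numbers such that $\alpha_i<0$ for $1\le i\le n-1$ and $2\alpha_n+\sum_{i=1}^{n-1}\alpha_i>0$; (iii) $x_{n+1}=\frac{1}{2x_1}\left(x_2^2+\cdots+x_{v-1}^2\right)-x_1\left(-\ln x_1+\alpha_v\ln x_v+\cdots+\alpha_n\ln x_n\right)$ (in the domain $x_1>0$, $x_i>0$ for $v\le i\le n$), where $v$ is an integer with $2\le v\le n+1$ and the $\alpha_i$ $(v\le i\le n)$ are real numbers such that $\alpha_i>0$ for $v\le i\le n$ and $\sum_{i=v}^{n}\alpha_i<1$ (empty sums are $0$). Here $x$ is locally centroaffinely equivalent to $H$ if every $p\in M$ has an open neighbourhood $U$ on which $x$ is injective, and for which some $g\in GL(n+1,\mathbb{R})$ maps $x(U)$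 onto a relatively open subset of $H$. If $M$ is connected, a single $H$ serves for all $p\in M$; in general, a single $H$ serves for all points of each connected component of $M$. -/

import Mathlib

open scoped ContDiff Manifold

noncomputable section

namespace Centroaffine

/-! ### Centroaffine invariants in coordinates

`f : E → F` is a local coordinate expression of a hypersurface, with `E = ℝⁿ` the space of
coordinates and `F = ℝⁿ⁺¹`. Elements `X Y Z W : E` stand for constant vector fields in the chart
(the linear combinations of the coordinate fields), so all their Lie brackets vanish. -/

section Coordinates

variable {E F : Type*} [NormedAddCommGroup E] [NormedSpace ℝ E]
  [NormedAddCommGroup F] [NormedSpace ℝ F]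

/-- The map `(X, a) ↦ f_* X + a f(u)`; it is an isomorphism `E × ℝ ≃ F` exactly when `f` is an
immersion at `u` with transversal position vector (and `dim F = dim E + 1`). -/
def frame (f : E → F) (u : E) : E × ℝ →L[ℝ] F :=
  (fderiv ℝ f u).coprod (ContinuousLinearMap.toSpanSingleton ℝ (f u))

/-- The induced connection `∇`: `inducedConnection f u X Y` is the value at `u` of `∇_X Y`,
i.e. `f_* (∇_X Y)` is the tangential part of `D_X (f_* Y)` with respect to the splitting of `F`
into the tangent space and the line spanned by the position vector. -/
def inducedConnection (f : E → F) (u : E) : E →L[ℝ] E →L[ℝ] E :=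
  (ContinuousLinearMap.compL ℝ E F E
    ((ContinuousLinearMap.fst ℝ E ℝ).comp (frame f u).inverse)).comp (fderiv ℝ (fderiv ℝ f) u)

/-- The centroaffine metric `h` with respect to the normal `-ε f`, determined by the Gauss formula
`D_X (f_* Y) = f_* (∇_X Y) + h(X, Y) (-ε f)`. As `ε = ±1`, `h(X, Y)` is `-ε` times the
coefficient of the position vector `f`. -/
def centroaffineMetric (ε : ℝ) (f : E → F) (u : E) : E →L[ℝ] E →L[ℝ] ℝ :=
  (-ε) • (ContinuousLinearMap.compL ℝ E F ℝ
    ((ContinuousLinearMap.snd ℝ E ℝ).comp (frame f u).inverse)).comp (fderiv ℝ (fderiv ℝ f) u)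

/-- The covector `Z ↦ ½ (X h(Y, Z) + Y h(X, Z) - Z h(X, Y))` at `u`: the Christoffel symbols of
the first kind of a metric `h`. -/
def koszul (h : E → E →L[ℝ] E →L[ℝ] ℝ) (u X Y : E) : E →L[ℝ] ℝ :=
  (1 / 2 : ℝ) • (fderiv ℝ h u X Y + fderiv ℝ h u Y X - ((fderiv ℝ h u).flip X).flip Y)

/-- The Levi-Civita connection `∇̂` of a metric `h`: `∇̂_X Y` at `u` is the vector with
`h(∇̂_X Y, Z) = ½ (X h(Y, Z) + Y h(X, Z) - Z h(X, Y))` for all `Z` (Koszul formula for constant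
fields). -/
def leviCivita (h : E → E →L[ℝ] E →L[ℝ] ℝ) (u X Y : E) : E :=
  (h u).inverse (koszul h u X Y)

/-- The curvature `R(X, Y) Z = ∇_X ∇_Y Z - ∇_Y ∇_X Z` at `u` of the connection with
Christoffel symbol `Γ`, for constant fields `X, Y, Z`. -/
def curvature (Γ : E → E → E → E) (u X Y Z : E) : E :=
  fderiv ℝ (fun w => Γ w Y Z) u X - fderiv ℝ (fun w => Γ w X Z) u Y
    + Γ u X (Γ u Y Z) - Γ u Y (Γ u X Z)

/-- The cubic form `C = ∇ h`, i.e.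
`C(X, Y, Z) = X (h(Y, Z)) - h(∇_X Y, Z) - h(Y, ∇_X Z)`, where `∇` is the induced connection. -/
def cubicForm (ε : ℝ) (f : E → F) (u X Y Z : E) : ℝ :=
  fderiv ℝ (fun w => centroaffineMetric ε f w Y Z) u X
    - centroaffineMetric ε f u (inducedConnection f u X Y) Z
    - centroaffineMetric ε f u Y (inducedConnection f u X Z)

/-- The covariant derivative `(∇_W C)(X, Y, Z)` of a trilinear form `C` with respect to the
connection with Christoffel symbol `Γ`. -/
def covDerivCubic (Γ : E → E → E → E) (C : E → E → E → E → ℝ) (u W X Y Z : E) : ℝ :=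
  fderiv ℝ (fun w => C w X Y Z) u W
    - C u (Γ u W X) Y Z - C u X (Γ u W Y) Z - C u X Y (Γ u W Z)

end Coordinates

/-! ### Centroaffine hypersurfaces

`M` is a smooth manifold of dimension `n` and `x : M → ℝⁿ⁺¹`. Tensorial conditions are expressed
in the charts `e` of the atlas of `M`, through the coordinate expression `x ∘ e.symm` on
`e.target`; they do not depend on the charts. -/

section Manifold

variable {n : ℕ} {M : Type*} [TopologicalSpace M] [ChartedSpace (EuclideanSpace ℝ (Fin n)) M]

/-- `x` is a smooth immersion whose position vector is everywhere transversal to the tangent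
hyperplane. -/
def IsCentroaffineHypersurface (x : M → (Fin (n + 1) → ℝ)) : Prop :=
  ContMDiff (𝓡 n) 𝓘(ℝ, Fin (n + 1) → ℝ) ∞ x ∧
  ∀ p : M, Function.Injective (mfderiv (𝓡 n) 𝓘(ℝ, Fin (n + 1) → ℝ) x p) ∧
    x p ∉ Set.range (mfderiv (𝓡 n) 𝓘(ℝ, Fin (n + 1) → ℝ) x p)

/-- The centroaffine metric of `x` with respect to the normal `-ε x` is positive definite. A
hypersurface is locally strongly convex when this holds for `ε = 1` (elliptic) or for `ε = -1`
(hyperbolic). -/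
def MetricPosDef (ε : ℝ) (x : M → (Fin (n + 1) → ℝ)) : Prop :=
  ∀ e ∈ atlas (EuclideanSpace ℝ (Fin n)) M, ∀ u ∈ e.target, ∀ X : EuclideanSpace ℝ (Fin n),
    X ≠ 0 → 0 < centroaffineMetric ε (x ∘ e.symm) u X X

/-- The centroaffine metric is flat: the curvature of its Levi-Civita connection vanishes. -/
def MetricFlat (ε : ℝ) (x : M → (Fin (n + 1) → ℝ)) : Prop :=
  ∀ e ∈ atlas (EuclideanSpace ℝ (Fin n)) M, ∀ u ∈ e.target,
    ∀ X Y Z : EuclideanSpace ℝ (Fin n),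
      curvature (leviCivita (centroaffineMetric ε (x ∘ e.symm))) u X Y Z = 0

/-- The cubic form is parallel with respect to the Levi-Civita connection of the centroaffine
metric: `∇̂ C = 0`. -/
def CubicFormParallel (ε : ℝ) (x : M → (Fin (n + 1) → ℝ)) : Prop :=
  ∀ e ∈ atlas (EuclideanSpace ℝ (Fin n)) M, ∀ u ∈ e.target,
    ∀ W X Y Z : EuclideanSpace ℝ (Fin n),
      covDerivCubic (leviCivita (centroaffineMetric ε (x ∘ e.symm)))
        (cubicForm ε (x ∘ e.symm)) u W X Y Z = 0

/-- A centroaffine hypersurface is canonical if its centroaffine metric is flat and its cubic form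
is parallel. (Replacing `ε` by `-ε` changes the signs of `h` and `C` and changes neither the
Levi-Civita connection nor this condition.) -/
def IsCanonical (ε : ℝ) (x : M → (Fin (n + 1) → ℝ)) : Prop :=
  MetricFlat ε x ∧ CubicFormParallel ε x

/-- Near `p`, the hypersurface `x` is centroaffinely equivalent to `H ⊆ ℝⁿ⁺¹`: some linear
automorphism of `ℝⁿ⁺¹` maps `x(U)`, for a neighbourhood `U` of `p` on which `x` is injective, onto
a relatively open part of `H`. -/
def LocallyEquivalentAt (x : M → (Fin (n + 1) → ℝ)) (p : M) (H : Set (Fin (n + 1) → ℝ)) : Prop :=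
  ∃ (g : (Fin (n + 1) → ℝ) ≃ₗ[ℝ] (Fin (n + 1) → ℝ)) (U : Set M) (V : Set (Fin (n + 1) → ℝ)),
    IsOpen U ∧ p ∈ U ∧ IsOpen V ∧ Set.InjOn x U ∧ g '' (x '' U) = H ∩ V

end Manifold

/-! ### The model hypersurfaces

Coordinates of `ℝⁿ⁺¹` are numbered `1, …, n + 1`, and parameters `α 1, α 2, …` likewise. -/

section Models

/-- The coordinate `x_k` of a point of `ℝⁿ⁺¹`, for `1 ≤ k ≤ n + 1`. -/
def coord {n : ℕ} (y : Fin (n + 1) → ℝ) (k : ℕ) : ℝ := y (Fin.ofNat (n + 1) (k - 1))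

/-- `x_1^{α_1} ⋯ x_{n+1}^{α_{n+1}} = 1`, in the domain where all coordinates are positive. -/
def productHypersurface (n : ℕ) (α : ℕ → ℝ) : Set (Fin (n + 1) → ℝ) :=
  {y | (∀ k ∈ Finset.Icc 1 (n + 1), 0 < coord y k) ∧
    ∏ k ∈ Finset.Icc 1 (n + 1), coord y k ^ α k = 1}

/-- `x_1^{α_1} ⋯ x_{n-1}^{α_{n-1}} (x_n² + x_{n+1}²)^{α_n} exp(α_{n+1} arctan(x_n / x_{n+1})) = 1`,
in the domain where `x_1, …, x_{n-1}` are positive and `x_{n+1} ≠ 0` (for `n ≥ 1`). -/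
def arctanHypersurface (n : ℕ) (α : ℕ → ℝ) : Set (Fin (n + 1) → ℝ) :=
  {y | (∀ k ∈ Finset.Icc 1 (n - 1), 0 < coord y k) ∧ coord y (n + 1) ≠ 0 ∧
    (∏ k ∈ Finset.Icc 1 (n - 1), coord y k ^ α k)
      * (coord y n ^ 2 + coord y (n + 1) ^ 2) ^ α n
      * Real.exp (α (n + 1) * Real.arctan (coord y n / coord y (n + 1))) = 1}

/-- `x_{n+1} = (1 / (2 x_1)) (x_2² + ⋯ + x_{v-1}²) - x_1 (-ln x_1 + α_v ln x_v + ⋯ + α_n ln x_n)`,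
in the domain where `x_1, x_v, …, x_n` are positive. -/
def logHypersurface (n v : ℕ) (α : ℕ → ℝ) : Set (Fin (n + 1) → ℝ) :=
  {y | 0 < coord y 1 ∧ (∀ k ∈ Finset.Icc v n, 0 < coord y k) ∧
    coord y (n + 1) =
      1 / (2 * coord y 1) * ∑ k ∈ Finset.Icc 2 (v - 1), coord y k ^ 2
        - coord y 1 * (-Real.log (coord y 1)
            + ∑ k ∈ Finset.Icc v n, α k * Real.log (coord y k))}

end Models

end Centroaffine

end

/-!
The tangent spaces and the position vector of a canonical hypersurface assemble to a family of
commutative associative algebras on `ℝⁿ⁺¹`, and the hypersurface is a level set of a function that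
such an algebra determines.

Let `K = ∇ - ∇̂`. The Codazzi equation makes `h(K_X Y, Z)` totally symmetric, so that
`C = -2 h(K · , ·)` and `K` is parallel for `∇̂`; as `h` is flat, the Gauss equation becomes the
algebraic identity `[K_X, K_Y] Z = ε (h(Y, Z) X - h(X, Z) Y)`
(`IsCanonicalOn.differenceTensor_comm`). It says that the product
`(f_* X + a f) (f_* Y + b f) = f_* (K_X Y + a Y + b X) + (a b - ε h(X, Y)) f` on `ℝⁿ⁺¹`
is associative. Its unit is the position vector `f`. With the conormal covector as counit this is
a `FrobeniusStructure`: the trace form `counit (v w)` is `-ε h` on the kernel of the counit.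

Write `·_u` for the product at `u` and `τ_u` for the counit. Parallelism gives
`∂_W (v ·_u w) = -(f_* W) ·_u (v ·_u w)` and `∂_W τ_u (v) = -τ_u ((f_* W) ·_u v)`. These linear
differential equations integrate to `f(u₀) ·_u (v ·_{u₀} w) = v ·_u w` and
`τ_{u₀} (f(u₀) ·_u v) = τ_u (v)` near `u₀` (`IsCanonicalOn.exists_ball`). Hence the isomorphism
class of the Frobenius structure is locally constant, so constant on connected components, and in
the algebra at `u₀` the logarithmic derivative `f⁻¹ f_* W` lies in the kernel of the counit: near
`u₀` the hypersurface is the level set of `counit ∘ log` through the unit. A linear map that puts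
the algebra into normal form therefore gives a centroaffine equivalence with a model
(`locallyEquivalentAt_of_hasModel`).

It remains to classify the algebras. The trace form is definite for `ε = -1`, and of signature
`(1, n)` for `ε = 1`.

* For `ε = -1` there are neither nilpotents nor complex factors, and the algebra is `ℝⁿ⁺¹` with
  counit `∑ α_i y_i`, `α_i > 0`. Then `counit ∘ log = ∑ α_i log y_i`.
* For `ε = 1` and a reduced algebra, a product of copies of `ℝ` and `ℂ`, the signature allows either
  one complex factor, with negative weights on all real ones, or none, with exactly one positive
  weight. The logarithm on `ℂ` produces the `arctan`.
* For `ε = 1`, an element `w ≠ 0` with `w² = 0` spans an isotropic ideal. The algebra acts on it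
  by a character `χ`, and on the common kernel of `χ` and the counit, where the trace form is
  definite, the product modulo `w` is diagonal in an orthonormal basis
  (`FrobeniusStructure.exists_coordinates_of_mul_self_eq_zero`).
-/

noncomputable section

open scoped ContDiff Manifold

set_option maxSynthPendingDepth 3
set_option linter.unusedSectionVars false

namespace Centroaffine

/-! ### The connections of a canonical hypersurface in coordinates -/

section Coordinates

variable {E V : Type*} [NormedAddCommGroup E] [NormedSpace ℝ E]
  [NormedAddCommGroup V] [NormedSpace ℝ V]

theorem frame_apply (f : E → V) (u : E) (a : E × ℝ) :
    frame f u a = fderiv ℝ f u a.1 + a.2 • f u := by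
  simp [frame]

/-- A canonical locally strongly convex hypersurface immersion in coordinates: `f` is smooth on the
open set `Ω`, its frames are invertible, the centroaffine metric is positive definite and flat, and
the cubic form is parallel. -/
structure IsCanonicalOn (ε : ℝ) (f : E → V) (Ω : Set E) : Prop where
  isOpen : IsOpen Ω
  sign_mul_self : ε * ε = 1
  contDiffOn : ContDiffOn ℝ ∞ f Ω
  invertible : ∀ u ∈ Ω, (frame f u).IsInvertible
  posDef : ∀ u ∈ Ω, ∀ X, X ≠ 0 → 0 < centroaffineMetric ε f u X X
  flat : ∀ u ∈ Ω, ∀ X Y Z, curvature (leviCivita (centroaffineMetric ε f)) u X Y Z = 0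
  parallel : ∀ u ∈ Ω, ∀ W X Y Z,
    covDerivCubic (leviCivita (centroaffineMetric ε f)) (cubicForm ε f) u W X Y Z = 0

/-- `koszul h u` as a continuous bilinear map with values in covectors. -/
def koszulL (h : E → E →L[ℝ] E →L[ℝ] ℝ) (u : E) : E →L[ℝ] E →L[ℝ] E →L[ℝ] ℝ :=
  (1 / 2 : ℝ) • (fderiv ℝ h u + (fderiv ℝ h u).flip -
    ((ContinuousLinearMap.flipₗᵢ ℝ E E ℝ : (E →L[ℝ] E →L[ℝ] ℝ) →L[ℝ] E →L[ℝ] E →L[ℝ] ℝ)).comp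
      (fderiv ℝ h u).flip)

theorem koszulL_apply (h : E → E →L[ℝ] E →L[ℝ] ℝ) (u X Y : E) :
    koszulL h u X Y = koszul h u X Y := by
  ext Z
  simp [koszulL, koszul]

/-- The Levi-Civita connection as a continuous bilinear map. -/
def leviCivitaL (h : E → E →L[ℝ] E →L[ℝ] ℝ) (u : E) : E →L[ℝ] E →L[ℝ] E :=
  (ContinuousLinearMap.compL ℝ E (E →L[ℝ] ℝ) E (h u).inverse).comp (koszulL h u)

theorem leviCivitaL_apply (h : E → E →L[ℝ] E →L[ℝ] ℝ) (u X Y : E) :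
    leviCivitaL h u X Y = leviCivita h u X Y := by
  simp [leviCivitaL, leviCivita, koszulL_apply]

/-- The difference tensor `K = ∇ - ∇̂`. -/
def differenceTensor (ε : ℝ) (f : E → V) (u : E) : E →L[ℝ] E →L[ℝ] E :=
  inducedConnection f u - leviCivitaL (centroaffineMetric ε f) u

variable {ε : ℝ} {f : E → V} {Ω : Set E} {u : E}

theorem IsCanonicalOn.contDiffAt (H : IsCanonicalOn ε f Ω) (hu : u ∈ Ω) : ContDiffAt ℝ ∞ f u :=
  H.contDiffOn.contDiffAt (H.isOpen.mem_nhds hu)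

theorem IsCanonicalOn.contDiffAt_fderiv (H : IsCanonicalOn ε f Ω) (hu : u ∈ Ω) :
    ContDiffAt ℝ ∞ (fderiv ℝ f) u :=
  (H.contDiffAt hu).fderiv_right (by simp)

theorem IsCanonicalOn.contDiffAt_fderiv_fderiv (H : IsCanonicalOn ε f Ω) (hu : u ∈ Ω) :
    ContDiffAt ℝ ∞ (fderiv ℝ (fderiv ℝ f)) u :=
  (H.contDiffAt_fderiv hu).fderiv_right (by simp)

theorem IsCanonicalOn.contDiffAt_frame (H : IsCanonicalOn ε f Ω) (hu : u ∈ Ω) :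
    ContDiffAt ℝ ∞ (frame f) u := by
  have h1 : frame f = fun u => (fderiv ℝ f u).comp (ContinuousLinearMap.fst ℝ E ℝ) +
      (ContinuousLinearMap.toSpanSingletonCLE (𝕜 := ℝ) (E := V) (f u)).comp
        (ContinuousLinearMap.snd ℝ E ℝ) := by
    ext u <;> simp [frame]
  rw [h1]
  exact ((H.contDiffAt_fderiv hu).clm_comp contDiffAt_const).add
    (((ContinuousLinearEquiv.contDiff _).contDiffAt.comp u
      (H.contDiffAt hu)).clm_comp contDiffAt_const)

theorem IsCanonicalOn.fderiv_frame_apply (H : IsCanonicalOn ε f Ω) (hu : u ∈ Ω) (W : E)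
    (a : E × ℝ) :
    fderiv ℝ (frame f) u W a = fderiv ℝ (fderiv ℝ f) u W a.1 + a.2 • fderiv ℝ f u W := by
  have h1 : HasFDerivAt (fun w => frame f w a)
      ((ContinuousLinearMap.apply ℝ V a).comp (fderiv ℝ (frame f) u)) u :=
    (ContinuousLinearMap.apply ℝ V a).hasFDerivAt.comp u
      ((H.contDiffAt_frame hu).differentiableAt (by simp)).hasFDerivAt
  have h2 : HasFDerivAt (fun w => frame f w a)
      ((ContinuousLinearMap.apply ℝ V a.1).comp (fderiv ℝ (fderiv ℝ f) u) +
        a.2 • fderiv ℝ f u) u := by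
    simp only [frame_apply]
    exact ((ContinuousLinearMap.apply ℝ V a.1).hasFDerivAt.comp u
      ((H.contDiffAt_fderiv hu).differentiableAt (by simp)).hasFDerivAt).add
      (((H.contDiffAt hu).differentiableAt (by simp)).hasFDerivAt.const_smul a.2)
  have := congrArg (fun L : E →L[ℝ] V => L W) (h1.unique h2)
  simpa using this

variable [FiniteDimensional ℝ E] [FiniteDimensional ℝ V]

theorem IsCanonicalOn.contDiffAt_frame_inverse (H : IsCanonicalOn ε f Ω) (hu : u ∈ Ω) :
    ContDiffAt ℝ ∞ (fun w => (frame f w).inverse) u := by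
  have : CompleteSpace E := FiniteDimensional.complete ℝ E
  exact ((H.invertible u hu).contDiffAt_map_inverse (n := ∞)).comp u (H.contDiffAt_frame hu)

theorem IsCanonicalOn.contDiffAt_inducedConnection (H : IsCanonicalOn ε f Ω) (hu : u ∈ Ω) :
    ContDiffAt ℝ ∞ (inducedConnection f) u :=
  (((ContinuousLinearMap.contDiff _).contDiffAt).comp u
    (contDiffAt_const.clm_comp (H.contDiffAt_frame_inverse hu))).clm_comp
      (H.contDiffAt_fderiv_fderiv hu)

theorem IsCanonicalOn.contDiffAt_metric (H : IsCanonicalOn ε f Ω) (hu : u ∈ Ω) :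
    ContDiffAt ℝ ∞ (centroaffineMetric ε f) u :=
  ContDiffAt.const_smul _ ((((ContinuousLinearMap.contDiff _).contDiffAt).comp u
    (contDiffAt_const.clm_comp (H.contDiffAt_frame_inverse hu))).clm_comp
      (H.contDiffAt_fderiv_fderiv hu))

theorem IsCanonicalOn.metric_isInvertible (H : IsCanonicalOn ε f Ω) (hu : u ∈ Ω) :
    (centroaffineMetric ε f u).IsInvertible := by
  have inj : Function.Injective (centroaffineMetric ε f u).toLinearMap := by
    rw [← LinearMap.ker_eq_bot, LinearMap.ker_eq_bot']
    intro X hX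
    by_contra h
    have := H.posDef u hu X h
    have h2 : centroaffineMetric ε f u X = 0 := hX
    simp [h2] at this
  have hd : Module.finrank ℝ E = Module.finrank ℝ (E →L[ℝ] ℝ) := by
    rw [← (LinearMap.toContinuousLinearMap : (E →ₗ[ℝ] ℝ) ≃ₗ[ℝ] E →L[ℝ] ℝ).finrank_eq]
    exact (Subspace.dual_finrank_eq).symm
  refine ⟨(LinearEquiv.ofInjectiveOfFinrankEq (centroaffineMetric ε f u).toLinearMap inj
    hd).toContinuousLinearEquiv, ?_⟩
  ext; rfl

theorem IsCanonicalOn.contDiffAt_leviCivitaL (H : IsCanonicalOn ε f Ω) (hu : u ∈ Ω) :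
    ContDiffAt ℝ ∞ (leviCivitaL (centroaffineMetric ε f)) u := by
  have : CompleteSpace E := FiniteDimensional.complete ℝ E
  have hD : ContDiffAt ℝ ∞ (fderiv ℝ (centroaffineMetric ε f)) u :=
    (H.contDiffAt_metric hu).fderiv_right (by simp)
  have hflip : ContDiffAt ℝ ∞ (fun w => (fderiv ℝ (centroaffineMetric ε f) w).flip) u :=
    ((ContinuousLinearMap.flipₗᵢ ℝ E E (E →L[ℝ] ℝ)).contDiff.contDiffAt).comp u hD
  have hk : ContDiffAt ℝ ∞ (koszulL (centroaffineMetric ε f)) u :=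
    ContDiffAt.const_smul _ ((hD.add hflip).sub (contDiffAt_const.clm_comp hflip))
  exact (((ContinuousLinearMap.contDiff _).contDiffAt).comp u
    (((H.metric_isInvertible hu).contDiffAt_map_inverse (n := ∞)).comp u
      (H.contDiffAt_metric hu))).clm_comp hk

theorem IsCanonicalOn.contDiffAt_differenceTensor (H : IsCanonicalOn ε f Ω) (hu : u ∈ Ω) :
    ContDiffAt ℝ ∞ (differenceTensor ε f) u :=
  (H.contDiffAt_inducedConnection hu).sub (H.contDiffAt_leviCivitaL hu)

end Coordinates

/-! ### The structure equations -/

section Structure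

variable {E V : Type*} [NormedAddCommGroup E] [NormedSpace ℝ E]
  [NormedAddCommGroup V] [NormedSpace ℝ V] [FiniteDimensional ℝ E] [FiniteDimensional ℝ V]
  {ε : ℝ} {f : E → V} {Ω : Set E} {u : E}

/-- The Gauss formula. -/
theorem IsCanonicalOn.gauss_formula (H : IsCanonicalOn ε f Ω) (hu : u ∈ Ω) (X Y : E) :
    fderiv ℝ (fderiv ℝ f) u X Y =
      frame f u (inducedConnection f u X Y, -ε * centroaffineMetric ε f u X Y) := by
  have h1 : (inducedConnection f u X Y, -ε * centroaffineMetric ε f u X Y) =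
      (frame f u).inverse (fderiv ℝ (fderiv ℝ f) u X Y) := by
    ext
    · simp [inducedConnection]
    · simp [centroaffineMetric, ← mul_assoc, H.sign_mul_self]
  rw [h1, (H.invertible u hu).self_apply_inverse]

theorem IsCanonicalOn.fderiv_fderiv_symm (H : IsCanonicalOn ε f Ω) (hu : u ∈ Ω) (X Y : E) :
    fderiv ℝ (fderiv ℝ f) u X Y = fderiv ℝ (fderiv ℝ f) u Y X :=
  ((H.contDiffAt hu).isSymmSndFDerivAt (by simpa using ENat.LEInfty.out)).eq X Y

theorem IsCanonicalOn.inducedConnection_symm (H : IsCanonicalOn ε f Ω) (hu : u ∈ Ω) (X Y : E) :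
    inducedConnection f u X Y = inducedConnection f u Y X := by
  simp [inducedConnection, H.fderiv_fderiv_symm hu X Y]

theorem IsCanonicalOn.metric_symm (H : IsCanonicalOn ε f Ω) (hu : u ∈ Ω) (X Y : E) :
    centroaffineMetric ε f u X Y = centroaffineMetric ε f u Y X := by
  simp [centroaffineMetric, H.fderiv_fderiv_symm hu X Y]

theorem IsCanonicalOn.fderiv_metric_apply (H : IsCanonicalOn ε f Ω) (hu : u ∈ Ω) (W X Y : E) :
    fderiv ℝ (fun w => centroaffineMetric ε f w X Y) u W =
      fderiv ℝ (centroaffineMetric ε f) u W X Y := by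
  have hd := (H.contDiffAt_metric hu).differentiableAt (by simp)
  rw [fderiv_clm_apply (hd.clm_apply (differentiableAt_const _)) (differentiableAt_const _),
    fderiv_clm_apply hd (differentiableAt_const _)]
  simp

theorem IsCanonicalOn.fderiv_metric_symm (H : IsCanonicalOn ε f Ω) (hu : u ∈ Ω) (W X Y : E) :
    fderiv ℝ (centroaffineMetric ε f) u W X Y = fderiv ℝ (centroaffineMetric ε f) u W Y X := by
  rw [← H.fderiv_metric_apply hu, ← H.fderiv_metric_apply hu]
  congr 1
  apply Filter.EventuallyEq.fderiv_eq
  filter_upwards [H.isOpen.mem_nhds hu] with w hw using H.metric_symm hw X Y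

theorem IsCanonicalOn.metric_leviCivitaL (H : IsCanonicalOn ε f Ω) (hu : u ∈ Ω) (X Y Z : E) :
    centroaffineMetric ε f u (leviCivitaL (centroaffineMetric ε f) u X Y) Z =
      koszul (centroaffineMetric ε f) u X Y Z := by
  rw [leviCivitaL_apply, leviCivita, (H.metric_isInvertible hu).self_apply_inverse]

theorem IsCanonicalOn.metric_injective (H : IsCanonicalOn ε f Ω) (hu : u ∈ Ω) {X Y : E}
    (h : ∀ Z, centroaffineMetric ε f u X Z = centroaffineMetric ε f u Y Z) : X = Y :=
  (H.metric_isInvertible hu).injective (ContinuousLinearMap.ext h)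

/-- The Levi-Civita connection is torsion-free. -/
theorem IsCanonicalOn.leviCivitaL_symm (H : IsCanonicalOn ε f Ω) (hu : u ∈ Ω) (X Y : E) :
    leviCivitaL (centroaffineMetric ε f) u X Y = leviCivitaL (centroaffineMetric ε f) u Y X := by
  refine H.metric_injective hu fun Z => ?_
  rw [H.metric_leviCivitaL hu, H.metric_leviCivitaL hu]
  simp [koszul, H.fderiv_metric_symm hu Z X Y]
  ring

/-- The Levi-Civita connection is metric. -/
theorem IsCanonicalOn.metric_compatible (H : IsCanonicalOn ε f Ω) (hu : u ∈ Ω) (W X Y : E) :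
    fderiv ℝ (centroaffineMetric ε f) u W X Y =
      centroaffineMetric ε f u (leviCivitaL (centroaffineMetric ε f) u W X) Y +
      centroaffineMetric ε f u X (leviCivitaL (centroaffineMetric ε f) u W Y) := by
  rw [H.metric_symm hu X, H.metric_leviCivitaL hu, H.metric_leviCivitaL hu]
  simp [koszul, H.fderiv_metric_symm hu X W Y, H.fderiv_metric_symm hu Y W X,
    H.fderiv_metric_symm hu W Y X]
  ring

theorem fderiv_clm_apply₂ {A G : Type*} [NormedAddCommGroup A] [NormedSpace ℝ A]
    [NormedAddCommGroup G] [NormedSpace ℝ G] {B : E → A →L[ℝ] G →L[ℝ] V}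
    (hB : DifferentiableAt ℝ B u) (W : E) (X : A) (Y : G) :
    fderiv ℝ (fun w => B w X Y) u W = fderiv ℝ B u W X Y := by
  rw [fderiv_clm_apply (hB.clm_apply (differentiableAt_const _)) (differentiableAt_const _),
    fderiv_clm_apply hB (differentiableAt_const _)]
  simp

/-- The derivative of the Gauss formula, i.e. the third derivative of `f` in the frame. -/
theorem IsCanonicalOn.fderiv_gauss_formula (H : IsCanonicalOn ε f Ω) (hu : u ∈ Ω) (X Y Z : E) :
    fderiv ℝ (fderiv ℝ (fderiv ℝ f)) u X Y Z =
      frame f u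
        (inducedConnection f u X (inducedConnection f u Y Z)
            - (ε * centroaffineMetric ε f u Y Z) • X + fderiv ℝ (inducedConnection f) u X Y Z,
          -ε * (centroaffineMetric ε f u X (inducedConnection f u Y Z)
            + fderiv ℝ (centroaffineMetric ε f) u X Y Z)) := by
  have hc := (H.contDiffAt_inducedConnection hu).differentiableAt (by simp)
  have hm := (H.contDiffAt_metric hu).differentiableAt (by simp)
  have hD := (H.contDiffAt_fderiv_fderiv hu).differentiableAt (by simp)
  have hF := (H.contDiffAt_frame hu).differentiableAt (by simp)
  have hcYZ : DifferentiableAt ℝ (fun w => inducedConnection f w Y Z) u := by fun_prop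
  have hmYZ : DifferentiableAt ℝ (fun w => -ε * centroaffineMetric ε f w Y Z) u := by fun_prop
  have h1 : fderiv ℝ (fun w => fderiv ℝ (fderiv ℝ f) w Y Z) u X =
      fderiv ℝ (fun w => frame f w
        (inducedConnection f w Y Z, -ε * centroaffineMetric ε f w Y Z)) u X := by
    congr 1
    apply Filter.EventuallyEq.fderiv_eq
    filter_upwards [H.isOpen.mem_nhds hu] with w hw using H.gauss_formula hw Y Z
  rw [fderiv_clm_apply₂ hD, fderiv_clm_apply hF (hcYZ.prodMk hmYZ),
    hcYZ.fderiv_prodMk hmYZ, fderiv_const_mul (by fun_prop)] at h1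
  rw [h1]
  simp only [add_apply, ContinuousLinearMap.comp_apply,
    ContinuousLinearMap.prod_apply, ContinuousLinearMap.flip_apply,
    smul_apply, H.fderiv_frame_apply hu, H.gauss_formula hu,
    fderiv_clm_apply₂ hc, H.fderiv_metric_apply hu, frame_apply, map_add, map_sub, map_smul,
    smul_eq_mul]
  module

theorem IsCanonicalOn.fderiv_gauss_formula_symm (H : IsCanonicalOn ε f Ω) (hu : u ∈ Ω)
    (X Y Z : E) :
    fderiv ℝ (fderiv ℝ (fderiv ℝ f)) u X Y Z = fderiv ℝ (fderiv ℝ (fderiv ℝ f)) u Y X Z := by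
  rw [((H.contDiffAt_fderiv hu).isSymmSndFDerivAt (by simpa using ENat.LEInfty.out)).eq X Y]

/-- The Codazzi equation. -/
theorem IsCanonicalOn.codazzi (H : IsCanonicalOn ε f Ω) (hu : u ∈ Ω) (X Y Z : E) :
    centroaffineMetric ε f u X (inducedConnection f u Y Z)
        + fderiv ℝ (centroaffineMetric ε f) u X Y Z =
      centroaffineMetric ε f u Y (inducedConnection f u X Z)
        + fderiv ℝ (centroaffineMetric ε f) u Y X Z := by
  have h := H.fderiv_gauss_formula_symm hu X Y Z
  rw [H.fderiv_gauss_formula hu, H.fderiv_gauss_formula hu] at h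
  have h2 := congrArg Prod.snd ((H.invertible u hu).injective h)
  have hε : ε ≠ 0 := fun h0 => by simpa [h0] using H.sign_mul_self
  simpa [hε] using h2

/-- The Gauss equation. -/
theorem IsCanonicalOn.gauss_equation (H : IsCanonicalOn ε f Ω) (hu : u ∈ Ω) (X Y Z : E) :
    inducedConnection f u X (inducedConnection f u Y Z)
        - (ε * centroaffineMetric ε f u Y Z) • X + fderiv ℝ (inducedConnection f) u X Y Z =
      inducedConnection f u Y (inducedConnection f u X Z)
        - (ε * centroaffineMetric ε f u X Z) • Y + fderiv ℝ (inducedConnection f) u Y X Z := by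
  have h := H.fderiv_gauss_formula_symm hu X Y Z
  rw [H.fderiv_gauss_formula hu, H.fderiv_gauss_formula hu] at h
  exact congrArg Prod.fst ((H.invertible u hu).injective h)

theorem inducedConnection_eq (ε : ℝ) (f : E → V) (u X Y : E) :
    inducedConnection f u X Y =
      leviCivitaL (centroaffineMetric ε f) u X Y + differenceTensor ε f u X Y := by
  simp [differenceTensor]

theorem IsCanonicalOn.differenceTensor_symm (H : IsCanonicalOn ε f Ω) (hu : u ∈ Ω) (X Y : E) :
    differenceTensor ε f u X Y = differenceTensor ε f u Y X := by
  simp [differenceTensor, H.inducedConnection_symm hu X Y, H.leviCivitaL_symm hu X Y]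

/-- `h(K_X Y, Z)` is totally symmetric. -/
theorem IsCanonicalOn.metric_differenceTensor_symm (H : IsCanonicalOn ε f Ω) (hu : u ∈ Ω)
    (X Y Z : E) :
    centroaffineMetric ε f u (differenceTensor ε f u X Y) Z =
      centroaffineMetric ε f u Y (differenceTensor ε f u X Z) := by
  -- the cubic form is symmetric in its first two arguments, by the Codazzi equation
  have key : ∀ X Y Z, centroaffineMetric ε f u (differenceTensor ε f u X Z) Y =
      centroaffineMetric ε f u (differenceTensor ε f u Y Z) X := by
    intro X Y Z
    have h := H.codazzi hu X Y Z
    simp only [H.metric_compatible hu, inducedConnection_eq ε, map_add] at h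
    rw [H.leviCivitaL_symm hu Y X] at h
    rw [H.metric_symm hu _ Y, H.metric_symm hu _ X]
    linarith
  rw [H.differenceTensor_symm hu X Y, key Y Z X, H.differenceTensor_symm hu Z X,
    H.metric_symm hu]

/-- The cubic form is `-2 h(K_X Y, Z)`. -/
theorem IsCanonicalOn.cubicForm_eq (H : IsCanonicalOn ε f Ω) (hu : u ∈ Ω) (X Y Z : E) :
    cubicForm ε f u X Y Z =
      -2 * centroaffineMetric ε f u (differenceTensor ε f u X Y) Z := by
  rw [cubicForm, H.fderiv_metric_apply hu, H.metric_compatible hu, inducedConnection_eq ε,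
    inducedConnection_eq ε]
  simp only [map_add, add_apply, ← H.metric_differenceTensor_symm hu]
  ring

/-- The difference tensor is parallel for the Levi-Civita connection. -/
theorem IsCanonicalOn.fderiv_differenceTensor (H : IsCanonicalOn ε f Ω) (hu : u ∈ Ω)
    (W X Y : E) :
    fderiv ℝ (differenceTensor ε f) u W X Y =
      differenceTensor ε f u (leviCivitaL (centroaffineMetric ε f) u W X) Y
      + differenceTensor ε f u X (leviCivitaL (centroaffineMetric ε f) u W Y)
      - leviCivitaL (centroaffineMetric ε f) u W (differenceTensor ε f u X Y) := by
  refine H.metric_injective hu fun Z => ?_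
  have hK := (H.contDiffAt_differenceTensor hu).differentiableAt (by simp)
  have hm := (H.contDiffAt_metric hu).differentiableAt (by simp)
  have hKXY : DifferentiableAt ℝ (fun w => differenceTensor ε f w X Y) u := by fun_prop
  have h := H.parallel u hu W X Y Z
  have h1 : fderiv ℝ (fun w => cubicForm ε f w X Y Z) u W =
      fderiv ℝ (fun w => -2 * centroaffineMetric ε f w (differenceTensor ε f w X Y) Z) u W := by
    congr 1
    apply Filter.EventuallyEq.fderiv_eq
    filter_upwards [H.isOpen.mem_nhds hu] with w hw using H.cubicForm_eq hw X Y Z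
  rw [fderiv_const_mul (by fun_prop), fderiv_clm_apply (by fun_prop) (by fun_prop),
    fderiv_clm_apply (by fun_prop) (by fun_prop)] at h1
  simp only [add_apply, ContinuousLinearMap.comp_apply,
    ContinuousLinearMap.flip_apply, smul_apply, fderiv_clm_apply₂ hK,
    fderiv_fun_const, Pi.zero_apply, zero_apply, map_zero, zero_add,
    smul_eq_mul, H.metric_compatible hu] at h1
  rw [covDerivCubic, h1] at h
  simp only [H.cubicForm_eq hu, ← leviCivitaL_apply] at h
  simp only [map_add, map_sub, add_apply, sub_apply]
  linarith

/-- The flatness of the metric and the parallelism of `K` turn the Gauss equation into an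
algebraic identity for `K`. -/
theorem IsCanonicalOn.differenceTensor_comm (H : IsCanonicalOn ε f Ω) (hu : u ∈ Ω) (X Y Z : E) :
    differenceTensor ε f u X (differenceTensor ε f u Y Z)
        - (ε * centroaffineMetric ε f u Y Z) • X =
      differenceTensor ε f u Y (differenceTensor ε f u X Z)
        - (ε * centroaffineMetric ε f u X Z) • Y := by
  have hK := (H.contDiffAt_differenceTensor hu).differentiableAt (by simp)
  have hL := (H.contDiffAt_leviCivitaL hu).differentiableAt (by simp)
  have hc : fderiv ℝ (inducedConnection f) u =
      fderiv ℝ (leviCivitaL (centroaffineMetric ε f)) u + fderiv ℝ (differenceTensor ε f) u := by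
    rw [← fderiv_add hL hK]
    congr 1
    ext w X Y
    simp [differenceTensor]
  have hflat := H.flat u hu X Y Z
  simp only [curvature, ← leviCivitaL_apply, fderiv_clm_apply₂ hL] at hflat
  have h := H.gauss_equation hu X Y Z
  simp only [hc, inducedConnection_eq ε, add_apply,
    H.fderiv_differenceTensor hu, map_add, H.leviCivitaL_symm hu Y X] at h
  rw [← sub_eq_zero] at h ⊢
  rw [← hflat, ← sub_eq_zero] at h
  rw [← h]
  abel

end Structure

/-! ### The product on the ambient space -/

section Product

variable {E V : Type*} [NormedAddCommGroup E] [NormedSpace ℝ E]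
  [NormedAddCommGroup V] [NormedSpace ℝ V]

/-- The product `(X, a) (Y, b) = (K_X Y + a Y + b X, a b - ε h(X, Y))` on `E × ℝ`, with unit
`(0, 1)`. -/
def frameProduct (ε : ℝ) (f : E → V) (u : E) : E × ℝ →L[ℝ] E × ℝ →L[ℝ] E × ℝ :=
  (ContinuousLinearMap.compL ℝ (E × ℝ) E (E × ℝ) (ContinuousLinearMap.inl ℝ E ℝ)).comp
      ((differenceTensor ε f u).bilinearComp (.fst ℝ E ℝ) (.fst ℝ E ℝ)
        + (ContinuousLinearMap.lsmul ℝ ℝ).bilinearComp (.snd ℝ E ℝ) (.fst ℝ E ℝ)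
        + (ContinuousLinearMap.lsmul ℝ ℝ).flip.bilinearComp (.fst ℝ E ℝ) (.snd ℝ E ℝ))
  + (ContinuousLinearMap.compL ℝ (E × ℝ) ℝ (E × ℝ) (ContinuousLinearMap.inr ℝ E ℝ)).comp
      ((ContinuousLinearMap.mul ℝ ℝ).bilinearComp (.snd ℝ E ℝ) (.snd ℝ E ℝ)
        - ε • (centroaffineMetric ε f u).bilinearComp (.fst ℝ E ℝ) (.fst ℝ E ℝ))

theorem frameProduct_apply (ε : ℝ) (f : E → V) (u : E) (a b : E × ℝ) :
    frameProduct ε f u a b =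
      (differenceTensor ε f u a.1 b.1 + a.2 • b.1 + b.2 • a.1,
        a.2 * b.2 - ε * centroaffineMetric ε f u a.1 b.1) := by
  simp [frameProduct]

/-- The product `frameProduct` transported to the ambient space by the frame. Its unit is the
position vector. -/
def ambientProduct (ε : ℝ) (f : E → V) (u : E) : V →L[ℝ] V →L[ℝ] V :=
  (ContinuousLinearMap.compL ℝ V (E × ℝ) V (frame f u)).comp
    ((frameProduct ε f u).bilinearComp (frame f u).inverse (frame f u).inverse)

/-- The conormal covector: it is `1` on the position vector and `0` on tangent vectors. -/
def conormal (f : E → V) (u : E) : V →L[ℝ] ℝ :=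
  (ContinuousLinearMap.snd ℝ E ℝ).comp (frame f u).inverse

variable [FiniteDimensional ℝ E] [FiniteDimensional ℝ V]
  {ε : ℝ} {f : E → V} {Ω : Set E} {u : E}

theorem conormal_frame (hF : (frame f u).IsInvertible) (a : E × ℝ) :
    conormal f u (frame f u a) = a.2 := by
  simp [conormal, hF.inverse_apply_self]

theorem conormal_position (hF : (frame f u).IsInvertible) : conormal f u (f u) = 1 := by
  simpa [frame_apply] using conormal_frame hF (0, 1)

theorem conormal_tangent (hF : (frame f u).IsInvertible) (X : E) :
    conormal f u (fderiv ℝ f u X) = 0 := by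
  simpa [frame_apply] using conormal_frame hF (X, 0)

theorem ambientProduct_frame (hF : (frame f u).IsInvertible) (a b : E × ℝ) :
    ambientProduct ε f u (frame f u a) (frame f u b) = frame f u (frameProduct ε f u a b) := by
  simp [ambientProduct, hF.inverse_apply_self]

theorem IsCanonicalOn.exists_frame (H : IsCanonicalOn ε f Ω) (hu : u ∈ Ω) (v : V) :
    ∃ a, frame f u a = v :=
  (H.invertible u hu).surjective v

theorem IsCanonicalOn.frameProduct_comm (H : IsCanonicalOn ε f Ω) (hu : u ∈ Ω) (a b : E × ℝ) :
    frameProduct ε f u a b = frameProduct ε f u b a := by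
  rw [frameProduct_apply, frameProduct_apply, H.differenceTensor_symm hu, H.metric_symm hu,
    mul_comm a.2, add_right_comm]

theorem IsCanonicalOn.ambientProduct_comm (H : IsCanonicalOn ε f Ω) (hu : u ∈ Ω) (v w : V) :
    ambientProduct ε f u v w = ambientProduct ε f u w v := by
  obtain ⟨a, rfl⟩ := H.exists_frame hu v
  obtain ⟨b, rfl⟩ := H.exists_frame hu w
  rw [ambientProduct_frame (H.invertible u hu), ambientProduct_frame (H.invertible u hu),
    H.frameProduct_comm hu]

/-- Associativity of the product is the algebraic identity
`IsCanonicalOn.differenceTensor_comm` together with the symmetry of `h(K_X Y, Z)`. -/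
theorem IsCanonicalOn.frameProduct_assoc (H : IsCanonicalOn ε f Ω) (hu : u ∈ Ω)
    (a b c : E × ℝ) :
    frameProduct ε f u (frameProduct ε f u a b) c =
      frameProduct ε f u a (frameProduct ε f u b c) := by
  obtain ⟨X, r⟩ := a
  obtain ⟨Y, s⟩ := b
  obtain ⟨Z, t⟩ := c
  simp only [frameProduct_apply, Prod.mk.injEq, map_add, map_smul, add_apply, smul_apply,
    smul_eq_mul]
  constructor
  · have h := H.differenceTensor_comm hu X Z Y
    rw [H.differenceTensor_symm hu X Y, H.differenceTensor_symm hu Z Y] at h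
    rw [H.differenceTensor_symm hu _ Z, H.differenceTensor_symm hu X Y, sub_smul, sub_smul,
      H.metric_symm hu Y Z]
    rw [← sub_eq_zero] at h ⊢
    rw [← neg_eq_zero, ← h]
    module
  · rw [H.differenceTensor_symm hu X Y, H.metric_differenceTensor_symm hu]
    ring

theorem IsCanonicalOn.ambientProduct_assoc (H : IsCanonicalOn ε f Ω) (hu : u ∈ Ω)
    (v w z : V) :
    ambientProduct ε f u (ambientProduct ε f u v w) z =
      ambientProduct ε f u v (ambientProduct ε f u w z) := by
  obtain ⟨a, rfl⟩ := H.exists_frame hu v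
  obtain ⟨b, rfl⟩ := H.exists_frame hu w
  obtain ⟨c, rfl⟩ := H.exists_frame hu z
  simp only [ambientProduct_frame (H.invertible u hu), H.frameProduct_assoc hu]

theorem IsCanonicalOn.ambientProduct_position (H : IsCanonicalOn ε f Ω) (hu : u ∈ Ω) (v : V) :
    ambientProduct ε f u (f u) v = v := by
  obtain ⟨a, rfl⟩ := H.exists_frame hu v
  have h1 : frame f u (0, 1) = f u := by simp [frame_apply]
  suffices ambientProduct ε f u (frame f u (0, 1)) (frame f u a) = frame f u a by rwa [h1] at this
  rw [ambientProduct_frame (H.invertible u hu), frameProduct_apply]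
  simp

/-- The restriction of the trace form of the product to the tangent space is `-ε h`. -/
theorem IsCanonicalOn.conormal_sq_pos (H : IsCanonicalOn ε f Ω) (hu : u ∈ Ω) {v : V}
    (hv : conormal f u v = 0) (hv0 : v ≠ 0) :
    0 < -ε * conormal f u (ambientProduct ε f u v v) := by
  have hF := H.invertible u hu
  obtain ⟨⟨X, r⟩, rfl⟩ := H.exists_frame hu v
  rw [conormal_frame hF] at hv
  simp only at hv
  subst hv
  have hX : X ≠ 0 := by
    rintro rfl
    exact hv0 (by simp [frame_apply])
  rw [ambientProduct_frame hF, conormal_frame hF, frameProduct_apply]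
  have := H.posDef u hu X hX
  have h2 := H.sign_mul_self
  simp only
  calc 0 < ε * ε * centroaffineMetric ε f u X X := by rw [h2, one_mul]; exact this
    _ = _ := by ring

theorem _root_.ContDiffAt.bilinearComp_const {E A B A' B' G : Type*}
    [NormedAddCommGroup E] [NormedSpace ℝ E] [NormedAddCommGroup A] [NormedSpace ℝ A]
    [NormedAddCommGroup B] [NormedSpace ℝ B] [NormedAddCommGroup A'] [NormedSpace ℝ A']
    [NormedAddCommGroup B'] [NormedSpace ℝ B'] [NormedAddCommGroup G] [NormedSpace ℝ G]
    {φ : E → A →L[ℝ] B →L[ℝ] G} {u : E} (hφ : ContDiffAt ℝ ∞ φ u)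
    (S : A' →L[ℝ] A) (T : B' →L[ℝ] B) :
    ContDiffAt ℝ ∞ (fun w => (φ w).bilinearComp S T) u := by
  have h1 : ContDiffAt ℝ ∞ (fun w => (φ w).comp S) u := hφ.clm_comp contDiffAt_const
  have h2 := ((ContinuousLinearMap.flipₗᵢ ℝ A' B G).contDiff.contDiffAt).comp u h1
  have h3 : ContDiffAt ℝ ∞ (fun w => ((φ w).comp S).flip.comp T) u :=
    h2.clm_comp contDiffAt_const
  exact ((ContinuousLinearMap.flipₗᵢ ℝ B' A' G).contDiff.contDiffAt).comp u h3

theorem IsCanonicalOn.contDiffAt_frameProduct (H : IsCanonicalOn ε f Ω) (hu : u ∈ Ω) :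
    ContDiffAt ℝ ∞ (frameProduct ε f) u := by
  have hK := H.contDiffAt_differenceTensor hu
  have hm := H.contDiffAt_metric hu
  exact (contDiffAt_const.clm_comp
    (((hK.bilinearComp_const _ _).add contDiffAt_const).add contDiffAt_const)).add
    (contDiffAt_const.clm_comp (contDiffAt_const.sub ((hm.bilinearComp_const _ _).const_smul ε)))

theorem IsCanonicalOn.contDiffAt_ambientProduct (H : IsCanonicalOn ε f Ω) (hu : u ∈ Ω) :
    ContDiffAt ℝ ∞ (ambientProduct ε f) u := by
  have hP := H.contDiffAt_frameProduct hu
  have hF := H.contDiffAt_frame hu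
  have hI := H.contDiffAt_frame_inverse hu
  have h1 := ((ContinuousLinearMap.flipₗᵢ ℝ V (E × ℝ) (E × ℝ)).contDiff.contDiffAt).comp u
    (hP.clm_comp hI)
  have h3 : ContDiffAt ℝ ∞ (fun w =>
    (((frameProduct ε f w).comp (frame f w).inverse).flip).comp (frame f w).inverse) u :=
    h1.clm_comp hI
  have h4 := ((ContinuousLinearMap.flipₗᵢ ℝ V V (E × ℝ)).contDiff.contDiffAt).comp u h3
  exact (((ContinuousLinearMap.compL ℝ V (E × ℝ) V).contDiff.contDiffAt).comp u hF).clm_comp h4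

theorem IsCanonicalOn.contDiffAt_conormal (H : IsCanonicalOn ε f Ω) (hu : u ∈ Ω) :
    ContDiffAt ℝ ∞ (conormal f) u :=
  contDiffAt_const.clm_comp (H.contDiffAt_frame_inverse hu)

/-- The derivative of the conormal covector is, up to sign, the trace form of the product. -/
theorem IsCanonicalOn.fderiv_conormal (H : IsCanonicalOn ε f Ω) (hu : u ∈ Ω) (W : E) (v : V) :
    fderiv ℝ (conormal f) u W v =
      - conormal f u (ambientProduct ε f u (fderiv ℝ f u W) v) := by
  have hF := (H.contDiffAt_frame hu).differentiableAt (by simp)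
  have hc := (H.contDiffAt_conormal hu).differentiableAt (by simp)
  have hinv := H.invertible u hu
  obtain ⟨a, rfl⟩ := H.exists_frame hu v
  have h1 : fderiv ℝ (fun w => conormal f w (frame f w a)) u W = 0 := by
    have : (fun w => conormal f w (frame f w a)) =ᶠ[nhds u] fun _ => a.2 := by
      filter_upwards [H.isOpen.mem_nhds hu] with w hw using conormal_frame (H.invertible w hw) a
    rw [this.fderiv_eq]
    simp
  rw [fderiv_clm_apply hc (by fun_prop), fderiv_clm_apply hF (by fun_prop)] at h1
  simp only [add_apply, ContinuousLinearMap.comp_apply, ContinuousLinearMap.flip_apply,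
    fderiv_fun_const, Pi.zero_apply, zero_apply, map_zero, zero_add, H.fderiv_frame_apply hu,
    H.gauss_formula hu, map_add, map_smul, conormal_frame hinv, conormal_tangent hinv] at h1
  have h2 : fderiv ℝ f u W = frame f u (W, 0) := by simp [frame_apply]
  rw [h2, ambientProduct_frame hinv, conormal_frame hinv, frameProduct_apply]
  simp only [smul_eq_mul, mul_zero, add_zero] at h1
  simp only [zero_mul, zero_sub]
  linarith

theorem IsCanonicalOn.fderiv_frameProduct (H : IsCanonicalOn ε f Ω) (hu : u ∈ Ω) (W : E)
    (a b : E × ℝ) :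
    fderiv ℝ (frameProduct ε f) u W a b =
      (fderiv ℝ (differenceTensor ε f) u W a.1 b.1,
        -ε * fderiv ℝ (centroaffineMetric ε f) u W a.1 b.1) := by
  have hK := (H.contDiffAt_differenceTensor hu).differentiableAt (by simp)
  have hm := (H.contDiffAt_metric hu).differentiableAt (by simp)
  have hP := (H.contDiffAt_frameProduct hu).differentiableAt (by simp)
  rw [← fderiv_clm_apply₂ hP]
  simp only [frameProduct_apply]
  rw [DifferentiableAt.fderiv_prodMk (by fun_prop) (by fun_prop)]
  simp only [ContinuousLinearMap.prod_apply]
  rw [fderiv_add_const, fderiv_add_const, fderiv_clm_apply₂ hK, fderiv_const_sub,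
    fderiv_const_mul (by fun_prop)]
  simp [fderiv_clm_apply₂ hm]

/-- Differentiating the product multiplies it by `-f_* W`: as `K` and `h` are parallel, only the
derivative of the frame contributes. -/
theorem IsCanonicalOn.fderiv_ambientProduct (H : IsCanonicalOn ε f Ω) (hu : u ∈ Ω) (W : E)
    (v w : V) :
    fderiv ℝ (ambientProduct ε f) u W v w =
      - ambientProduct ε f u (fderiv ℝ f u W) (ambientProduct ε f u v w) := by
  have hF := (H.contDiffAt_frame hu).differentiableAt (by simp)
  have hA := (H.contDiffAt_ambientProduct hu).differentiableAt (by simp)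
  have hP := (H.contDiffAt_frameProduct hu).differentiableAt (by simp)
  have hinv := H.invertible u hu
  obtain ⟨a, rfl⟩ := H.exists_frame hu v
  obtain ⟨b, rfl⟩ := H.exists_frame hu w
  have h1 : fderiv ℝ (fun w => ambientProduct ε f w (frame f w a) (frame f w b)) u W =
      fderiv ℝ (fun w => frame f w (frameProduct ε f w a b)) u W := by
    congr 1
    apply Filter.EventuallyEq.fderiv_eq
    filter_upwards [H.isOpen.mem_nhds hu] with w hw
      using ambientProduct_frame (H.invertible w hw) a b
  have hFr : ∀ c : E × ℝ, fderiv ℝ (frame f) u W c = frame f u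
      (leviCivitaL (centroaffineMetric ε f) u W c.1, 0) +
      frame f u (frameProduct ε f u (W, 0) c) := by
    intro c
    rw [H.fderiv_frame_apply hu, H.gauss_formula hu, inducedConnection_eq ε, frameProduct_apply]
    simp only [frame_apply, map_add, map_smul]
    module
  rw [fderiv_clm_apply (by fun_prop) (by fun_prop), fderiv_clm_apply hA (by fun_prop),
    fderiv_clm_apply hF (by fun_prop), fderiv_clm_apply hF (by fun_prop),
    fderiv_clm_apply hF (by fun_prop)] at h1
  simp only [add_apply, ContinuousLinearMap.comp_apply, ContinuousLinearMap.flip_apply,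
    fderiv_fun_const, Pi.zero_apply, zero_apply, map_zero, zero_add,
    hFr, map_add, ambientProduct_frame hinv, fderiv_clm_apply₂ hP] at h1
  have h2 : fderiv ℝ f u W = frame f u (W, 0) := by simp [frame_apply]
  rw [h2, ambientProduct_frame hinv, ambientProduct_frame hinv]
  have hpar : fderiv ℝ (frameProduct ε f) u W a b
      + (leviCivitaL (centroaffineMetric ε f) u W (frameProduct ε f u a b).1, 0) =
      frameProduct ε f u a (leviCivitaL (centroaffineMetric ε f) u W b.1, 0)
      + frameProduct ε f u (leviCivitaL (centroaffineMetric ε f) u W a.1, 0) b := by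
    simp only [H.fderiv_frameProduct hu, frameProduct_apply, H.fderiv_differenceTensor hu,
      H.metric_compatible hu, Prod.mk_add_mk, Prod.mk.injEq, map_add, map_smul]
    constructor
    · module
    · ring
  have hassoc := H.frameProduct_assoc hu (W, 0) a b
  have hcomm : frameProduct ε f u a (frameProduct ε f u (W, 0) b) =
      frameProduct ε f u (W, 0) (frameProduct ε f u a b) := by
    rw [← H.frameProduct_assoc hu, H.frameProduct_comm hu a, H.frameProduct_assoc hu]
  have hpar' := congrArg (frame f u) hpar
  rw [map_add, map_add] at hpar'
  rw [hassoc, hcomm] at h1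
  rw [← sub_eq_zero] at h1 hpar' ⊢
  rw [← add_zero (0 : V)]
  nth_rewrite 1 [← h1]
  rw [← hpar']
  abel

end Product

/-! ### Frobenius structures and their local constancy -/

/-- A commutative, associative and unital product on `V` together with a linear form `counit`,
normalised by `counit 1 = 1`, such that `-ε · counit (v v)` is positive definite on the kernel of
`counit`. -/
structure FrobeniusStructure (ε : ℝ) (V : Type*) [NormedAddCommGroup V] [NormedSpace ℝ V] where
  /-- the product -/
  mul : V →L[ℝ] V →L[ℝ] V
  /-- the unit -/
  one : V
  /-- the linear form -/
  counit : V →L[ℝ] ℝ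
  mul_comm : ∀ v w, mul v w = mul w v
  mul_assoc : ∀ v w z, mul (mul v w) z = mul v (mul w z)
  one_mul : ∀ v, mul one v = v
  counit_one : counit one = 1
  pos : ∀ v, counit v = 0 → v ≠ 0 → 0 < -ε * counit (mul v v)

namespace FrobeniusStructure

variable {ε : ℝ} {V : Type*} [NormedAddCommGroup V] [NormedSpace ℝ V]

/-- Isomorphism of Frobenius structures. -/
def Equivalent (A B : FrobeniusStructure ε V) : Prop :=
  ∃ φ : V ≃ₗ[ℝ] V, (∀ v w, φ (A.mul v w) = B.mul (φ v) (φ w)) ∧ ∀ v, B.counit (φ v) = A.counit v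

theorem Equivalent.symm {A B : FrobeniusStructure ε V} (h : A.Equivalent B) : B.Equivalent A := by
  obtain ⟨φ, h1, h2⟩ := h
  refine ⟨φ.symm, fun v w => φ.injective ?_, fun v => ?_⟩
  · rw [h1]; simp
  · rw [← h2]; simp

theorem Equivalent.trans {A B C : FrobeniusStructure ε V} (h : A.Equivalent B)
    (h' : B.Equivalent C) : A.Equivalent C := by
  obtain ⟨φ, h1, h2⟩ := h
  obtain ⟨ψ, h3, h4⟩ := h'
  exact ⟨φ.trans ψ, fun v w => by simp [h1, h3], fun v => by simp [h2, h4]⟩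

theorem Equivalent.refl (A : FrobeniusStructure ε V) : A.Equivalent A :=
  ⟨LinearEquiv.refl ℝ V, fun _ _ => rfl, fun _ => rfl⟩

theorem mul_one (A : FrobeniusStructure ε V) (v : V) : A.mul v A.one = v := by
  rw [A.mul_comm, A.one_mul]

/-- The trace form `counit (v w)` is nondegenerate. -/
theorem eq_of_counit_mul (A : FrobeniusStructure ε V) {v w : V}
    (h : ∀ z, A.counit (A.mul v z) = A.counit (A.mul w z)) : v = w := by
  rw [← sub_eq_zero]
  by_contra hne
  have h1 := A.pos (v - w) (by simpa [A.mul_one, sub_eq_zero] using h A.one) hne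
  have h2 := h (v - w)
  rw [A.mul.map_sub v w, sub_apply, map_sub, h2] at h1
  simp at h1

end FrobeniusStructure

section Local

/-- A linear homogeneous differential inequality forces a function that vanishes at one point of a
convex open set to vanish identically. -/
theorem eq_zero_of_norm_fderiv_le {E Z : Type*} [NormedAddCommGroup E] [NormedSpace ℝ E]
    [NormedAddCommGroup Z] [NormedSpace ℝ Z] {g : E → Z} {s : Set E} (hs : Convex ℝ s)
    (hg : ∀ u ∈ s, DifferentiableAt ℝ g u) {C : ℝ}
    (hC : ∀ u ∈ s, ∀ W, ‖fderiv ℝ g u W‖ ≤ C * ‖W‖ * ‖g u‖) {u₀ : E} (hu₀ : u₀ ∈ s)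
    (h0 : g u₀ = 0) {u : E} (hu : u ∈ s) : g u = 0 := by
  set γ : ℝ → E := fun t => u₀ + t • (u - u₀) with hγ
  have hmem : ∀ t ∈ Set.Icc (0 : ℝ) 1, γ t ∈ s := fun t ht => hs.add_smul_sub_mem hu₀ hu ht
  have hd : ∀ t, HasDerivAt γ (u - u₀) t := fun t => by
    simpa [hγ] using ((hasDerivAt_id t).smul_const (u - u₀)).const_add u₀
  have hgd : ∀ t ∈ Set.Icc (0 : ℝ) 1, HasDerivAt (g ∘ γ) (fderiv ℝ g (γ t) (u - u₀)) t :=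
    fun t ht => (hg _ (hmem t ht)).hasFDerivAt.comp_hasDerivAt t (hd t)
  have := eq_zero_of_abs_deriv_le_mul_abs_self_of_eq_zero_right (f := g ∘ γ)
    (f' := fun t => fderiv ℝ g (γ t) (u - u₀)) (K := C * ‖u - u₀‖) (a := 0) (b := 1)
    (fun t ht => (hgd t ht).continuousAt.continuousWithinAt)
    (fun t ht => (hgd t ⟨ht.1, ht.2.le⟩).hasDerivWithinAt) (by simp [hγ, h0])
    (fun t ht => hC _ (hmem t ⟨ht.1, ht.2.le⟩) _) 1 (by simp)
  simpa [hγ] using this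

variable {E V : Type*} [NormedAddCommGroup E] [NormedSpace ℝ E]
  [NormedAddCommGroup V] [NormedSpace ℝ V] [FiniteDimensional ℝ E] [FiniteDimensional ℝ V]
  {ε : ℝ} {f : E → V} {Ω : Set E}

/-- The Frobenius structure of a canonical hypersurface at a point. -/
def IsCanonicalOn.frobenius (H : IsCanonicalOn ε f Ω) {u : E} (hu : u ∈ Ω) :
    FrobeniusStructure ε V where
  mul := ambientProduct ε f u
  one := f u
  counit := conormal f u
  mul_comm := H.ambientProduct_comm hu
  mul_assoc := H.ambientProduct_assoc hu
  one_mul := H.ambientProduct_position hu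
  counit_one := conormal_position (H.invertible u hu)
  pos _ h h0 := H.conormal_sq_pos hu h h0

/-- Near `u₀`, multiplication by `f u₀` in the structure at `u` relates the structure at `u₀` to
the structure at `u`. Both identities hold at `u₀`, and the differences of their sides solve linear
homogeneous differential equations. -/
theorem IsCanonicalOn.exists_ball (H : IsCanonicalOn ε f Ω) {u₀ : E} (hu₀ : u₀ ∈ Ω) :
    ∃ r > 0, Metric.ball u₀ r ⊆ Ω ∧ ∀ u ∈ Metric.ball u₀ r,
      (∀ v w, ambientProduct ε f u (f u₀) (ambientProduct ε f u₀ v w) =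
        ambientProduct ε f u v w) ∧
      ∀ v, conormal f u₀ (ambientProduct ε f u (f u₀) v) = conormal f u v := by
  set L : E → E →L[ℝ] V →L[ℝ] V := fun u => (ambientProduct ε f u).comp (fderiv ℝ f u) with hL
  have hLc : ContinuousAt L u₀ :=
    ((H.contDiffAt_ambientProduct hu₀).clm_comp (H.contDiffAt_fderiv hu₀)).continuousAt
  have hev : ∀ᶠ u in nhds u₀, u ∈ Ω ∧ ‖L u‖ < ‖L u₀‖ + 1 :=
    Filter.Eventually.and (H.isOpen.mem_nhds hu₀)
      (hLc.norm.eventually (gt_mem_nhds (lt_add_one _)))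
  obtain ⟨r, hr, hball⟩ := Metric.eventually_nhds_iff_ball.1 hev
  set C := ‖L u₀‖ + 1
  have hC0 : 0 ≤ C := by positivity
  have hLb : ∀ u ∈ Metric.ball u₀ r, ∀ W z, ‖L u W z‖ ≤ C * ‖W‖ * ‖z‖ := fun u hu W z =>
    ((L u).le_opNorm₂ W z).trans (by gcongr; exact (hball u hu).2.le)
  refine ⟨r, hr, fun u hu => (hball u hu).1, fun u hu => ?_⟩
  have hA : ∀ u ∈ Metric.ball u₀ r, DifferentiableAt ℝ (ambientProduct ε f) u := fun u hu =>
    (H.contDiffAt_ambientProduct (hball u hu).1).differentiableAt (by simp)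
  constructor
  · intro v w
    rw [← sub_eq_zero]
    refine eq_zero_of_norm_fderiv_le (g := fun u => ambientProduct ε f u (f u₀)
      (ambientProduct ε f u₀ v w) - ambientProduct ε f u v w) (convex_ball u₀ r) ?_ (C := C) ?_
      (Metric.mem_ball_self hr) ?_ hu
    · intro u hu
      have := hA u hu
      fun_prop
    · intro u hu W
      have := hA u hu
      rw [fderiv_fun_sub (by fun_prop) (by fun_prop), sub_apply, fderiv_clm_apply₂ this,
        fderiv_clm_apply₂ this, H.fderiv_ambientProduct (hball u hu).1,
        H.fderiv_ambientProduct (hball u hu).1, ← neg_sub_neg, neg_neg, neg_neg, ← map_sub,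
        norm_sub_rev]
      exact hLb u hu W _
    · simp [H.ambientProduct_position hu₀]
  · intro v
    rw [← sub_eq_zero]
    have hc : ∀ u ∈ Metric.ball u₀ r, DifferentiableAt ℝ (conormal f) u := fun u hu =>
      (H.contDiffAt_conormal (hball u hu).1).differentiableAt (by simp)
    have h0 : (conormal f u₀).comp (ambientProduct ε f u (f u₀)) - conormal f u = 0 := by
      refine eq_zero_of_norm_fderiv_le (g := fun u => (conormal f u₀).comp
        (ambientProduct ε f u (f u₀)) - conormal f u) (convex_ball u₀ r) ?_ (C := C) ?_
        (Metric.mem_ball_self hr) ?_ hu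
      · intro u hu
        have := hA u hu
        have := hc u hu
        fun_prop
      · intro u hu W
        have hAu := hA u hu
        have hcu := hc u hu
        have hΩ := (hball u hu).1
        have key : fderiv ℝ (fun u => (conormal f u₀).comp
            (ambientProduct ε f u (f u₀)) - conormal f u) u W =
            -(((conormal f u₀).comp (ambientProduct ε f u (f u₀)) - conormal f u).comp
              (L u W)) := by
          ext v
          rw [fderiv_fun_sub (by fun_prop) (by fun_prop), fderiv_clm_comp (by fun_prop)
            (by fun_prop), fderiv_clm_apply hAu (by fun_prop)]
          simp [hL, H.fderiv_ambientProduct hΩ, H.fderiv_conormal hΩ]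
          rw [← H.ambientProduct_assoc hΩ, H.ambientProduct_comm hΩ _ (f u₀),
            H.ambientProduct_assoc hΩ]
          ring
        rw [key, norm_neg, mul_comm]
        refine (ContinuousLinearMap.opNorm_comp_le _ _).trans ?_
        gcongr
        exact ((L u).le_opNorm W).trans (by gcongr; exact (hball u hu).2.le)
      · ext v
        simp [H.ambientProduct_position hu₀]
    exact congrArg (fun l : V →L[ℝ] ℝ => l v) h0

/-- The isomorphism class of the Frobenius structure is locally constant. -/
theorem IsCanonicalOn.eventually_equivalent (H : IsCanonicalOn ε f Ω) {u₀ : E} (hu₀ : u₀ ∈ Ω) :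
    ∀ᶠ u in nhds u₀, ∃ hu : u ∈ Ω, (H.frobenius hu₀).Equivalent (H.frobenius hu) := by
  obtain ⟨r, hr, hsub, hball⟩ := H.exists_ball hu₀
  filter_upwards [Metric.ball_mem_nhds u₀ hr] with u hu
  have hΩ := hsub hu
  obtain ⟨h1, h2⟩ := hball u hu
  have hN : ∀ v, ambientProduct ε f u (f u₀) (ambientProduct ε f u₀ (f u) v) = v := fun v => by
    rw [h1, H.ambientProduct_position hΩ]
  have hinj : Function.Injective (ambientProduct ε f u₀ (f u)).toLinearMap := fun v w h => by
    rw [← hN v, ← hN w]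
    exact congrArg _ h
  refine ⟨hΩ, LinearEquiv.ofInjectiveEndo _ hinj, fun v w => ?_, fun v => ?_⟩
  · change ambientProduct ε f u₀ (f u) (ambientProduct ε f u₀ v w) = ambientProduct ε f u
      (ambientProduct ε f u₀ (f u) v) (ambientProduct ε f u₀ (f u) w)
    rw [← h1, H.ambientProduct_assoc hu₀ (f u) v, hN, ← H.ambientProduct_assoc hu₀ v,
      H.ambientProduct_comm hu₀ v (f u), H.ambientProduct_assoc hu₀]
  · change conormal f u (ambientProduct ε f u₀ (f u) v) = conormal f u₀ v
    rw [← h2, hN]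

/-- In the Frobenius structure at `u₀` the logarithmic derivative of `f` takes values in the kernel
of the counit. -/
theorem IsCanonicalOn.eventually_logDeriv (H : IsCanonicalOn ε f Ω) {u₀ : E} (hu₀ : u₀ ∈ Ω) :
    ∀ᶠ u in nhds u₀, ∀ W, ∃ z, conormal f u₀ z = 0 ∧
      fderiv ℝ f u W = ambientProduct ε f u₀ (f u) z := by
  obtain ⟨r, hr, hsub, hball⟩ := H.exists_ball hu₀
  filter_upwards [Metric.ball_mem_nhds u₀ hr] with u hu W
  have hΩ := hsub hu
  obtain ⟨h1, h2⟩ := hball u hu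
  have hN : ∀ v, ambientProduct ε f u (f u₀) (ambientProduct ε f u₀ (f u) v) = v := fun v => by
    rw [h1, H.ambientProduct_position hΩ]
  have hsurj : Function.Surjective (ambientProduct ε f u₀ (f u)).toLinearMap :=
    LinearMap.surjective_of_injective fun v w h => by
      rw [← hN v, ← hN w]
      exact congrArg _ h
  obtain ⟨z, hz⟩ := hsurj (fderiv ℝ f u W)
  refine ⟨z, ?_, hz.symm⟩
  rw [← hN z, h2]
  exact (congrArg _ hz).trans (conormal_tangent (H.invertible u hΩ) W)

end Local

/-! ### Independence of the coordinates -/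

section ChangeOfCoordinates

variable {E V : Type*} [NormedAddCommGroup E] [NormedSpace ℝ E]
  [NormedAddCommGroup V] [NormedSpace ℝ V] [FiniteDimensional ℝ E] [FiniteDimensional ℝ V]
  {ε : ℝ} {f f' : E → V} {Ω Ω' : Set E} {ψ : E → E}

open Filter Topology

theorem IsCanonicalOn.exists_tangent_add (H : IsCanonicalOn ε f Ω) {u : E} (hu : u ∈ Ω) (v : V) :
    ∃ (W : E) (a : ℝ), v = fderiv ℝ f u W + a • f u := by
  obtain ⟨a, rfl⟩ := H.exists_frame hu v
  exact ⟨a.1, a.2, frame_apply _ _ _⟩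

theorem fderiv_eq_of_eventuallyEq_comp (H' : IsCanonicalOn ε f' Ω') {u : E} (hψu : ψ u ∈ Ω')
    (hψ : DifferentiableAt ℝ ψ u) (hf : f =ᶠ[𝓝 u] f' ∘ ψ) (W : E) :
    fderiv ℝ f u W = fderiv ℝ f' (ψ u) (fderiv ℝ ψ u W) := by
  rw [hf.fderiv_eq, fderiv_comp u ((H'.contDiffAt hψu).differentiableAt (by simp)) hψ]
  rfl

theorem conormal_eq_of_eventuallyEq_comp (H : IsCanonicalOn ε f Ω) (H' : IsCanonicalOn ε f' Ω')
    {u : E} (hu : u ∈ Ω) (hψu : ψ u ∈ Ω') (hψ : DifferentiableAt ℝ ψ u)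
    (hf : f =ᶠ[𝓝 u] f' ∘ ψ) : conormal f u = conormal f' (ψ u) := by
  ext v
  obtain ⟨W, a, rfl⟩ := H.exists_tangent_add hu v
  rw [map_add, map_add, map_smul, map_smul, conormal_tangent (H.invertible u hu),
    conormal_position (H.invertible u hu), fderiv_eq_of_eventuallyEq_comp H' hψu hψ hf,
    conormal_tangent (H'.invertible _ hψu), hf.eq_of_nhds, Function.comp_apply,
    conormal_position (H'.invertible _ hψu)]

/-- The trace form of the Frobenius structure is the derivative of the conormal covector, hence
does not depend on the coordinates. -/
theorem conormal_ambientProduct_eq (H : IsCanonicalOn ε f Ω) (H' : IsCanonicalOn ε f' Ω')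
    {u : E} (hu : u ∈ Ω) (hψu : ψ u ∈ Ω') (hψ : ∀ᶠ w in 𝓝 u, DifferentiableAt ℝ ψ w)
    (hf : f =ᶠ[𝓝 u] f' ∘ ψ) (v w : V) :
    conormal f u (ambientProduct ε f u v w) =
      conormal f' (ψ u) (ambientProduct ε f' (ψ u) v w) := by
  have hc : conormal f =ᶠ[𝓝 u] conormal f' ∘ ψ := by
    filter_upwards [H.isOpen.mem_nhds hu, hψ, hf.eventuallyEq_nhds,
      hψ.self_of_nhds.continuousAt.preimage_mem_nhds (H'.isOpen.mem_nhds hψu)] with w h1 h2 h3 h4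
    exact conormal_eq_of_eventuallyEq_comp H H' h1 h4 h2 h3
  obtain ⟨W, a, rfl⟩ := H.exists_tangent_add hu v
  have hd : fderiv ℝ (conormal f) u W w =
      fderiv ℝ (conormal f') (ψ u) (fderiv ℝ ψ u W) w := by
    rw [hc.fderiv_eq, fderiv_comp u ((H'.contDiffAt_conormal hψu).differentiableAt (by simp))
      hψ.self_of_nhds]
    rfl
  rw [H.fderiv_conormal hu, H'.fderiv_conormal hψu,
    ← fderiv_eq_of_eventuallyEq_comp H' hψu hψ.self_of_nhds hf, neg_inj] at hd
  have hfu : f u = f' (ψ u) := hf.eq_of_nhds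
  simp only [map_add, map_smul, add_apply, smul_apply, hd, H.ambientProduct_position hu]
  rw [hfu, H'.ambientProduct_position hψu,
    conormal_eq_of_eventuallyEq_comp H H' hu hψu hψ.self_of_nhds hf]

/-- The product on the ambient space does not depend on the coordinates: `counit (v w z)` is given
by the second derivative of the conormal covector, and the trace form is nondegenerate. -/
theorem ambientProduct_eq_of_eventuallyEq_comp (H : IsCanonicalOn ε f Ω)
    (H' : IsCanonicalOn ε f' Ω') {u : E} (hu : u ∈ Ω) (hψu : ψ u ∈ Ω')
    (hψ : ∀ᶠ w in 𝓝 u, DifferentiableAt ℝ ψ w) (hf : f =ᶠ[𝓝 u] f' ∘ ψ) :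
    ambientProduct ε f u = ambientProduct ε f' (ψ u) := by
  have hc0 := conormal_eq_of_eventuallyEq_comp H H' hu hψu hψ.self_of_nhds hf
  have hB := conormal_ambientProduct_eq H H' hu hψu hψ hf
  have hT : ∀ v w z, conormal f u (ambientProduct ε f u v (ambientProduct ε f u w z)) =
      conormal f' (ψ u) (ambientProduct ε f' (ψ u) v (ambientProduct ε f' (ψ u) w z)) := by
    intro v w z
    have hc : (fun x => conormal f x (ambientProduct ε f x w z)) =ᶠ[𝓝 u]
        (fun y => conormal f' y (ambientProduct ε f' y w z)) ∘ ψ := by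
      filter_upwards [H.isOpen.mem_nhds hu, hψ.eventually_nhds, hf.eventuallyEq_nhds,
        hψ.self_of_nhds.continuousAt.preimage_mem_nhds (H'.isOpen.mem_nhds hψu)]
        with x h1 h2 h3 h4
      exact conormal_ambientProduct_eq H H' h1 h4 h2 h3 w z
    have hder : ∀ {g : E → V} {O : Set E} (_ : IsCanonicalOn ε g O) {x : E} (_ : x ∈ O),
        DifferentiableAt ℝ (fun y => conormal g y (ambientProduct ε g y w z)) x ∧ ∀ W,
        fderiv ℝ (fun y => conormal g y (ambientProduct ε g y w z)) x W =
        -2 * conormal g x (ambientProduct ε g x (fderiv ℝ g x W) (ambientProduct ε g x w z)) := by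
      intro g O G x hx
      have h1 := (G.contDiffAt_conormal hx).differentiableAt (by simp)
      have h2 := (G.contDiffAt_ambientProduct hx).differentiableAt (by simp)
      refine ⟨by fun_prop, fun W => ?_⟩
      rw [fderiv_clm_apply h1 (by fun_prop)]
      simp only [add_apply, ContinuousLinearMap.comp_apply, ContinuousLinearMap.flip_apply,
        fderiv_clm_apply₂ h2, G.fderiv_ambientProduct hx, G.fderiv_conormal hx, map_neg]
      ring
    obtain ⟨W, a, rfl⟩ := H.exists_tangent_add hu v
    have hd := congrArg (fun L : E →L[ℝ] ℝ => L W) hc.fderiv_eq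
    rw [fderiv_comp u (hder H' hψu).1 hψ.self_of_nhds] at hd
    simp only [ContinuousLinearMap.comp_apply] at hd
    rw [(hder H hu).2, (hder H' hψu).2,
      ← fderiv_eq_of_eventuallyEq_comp H' hψu hψ.self_of_nhds hf] at hd
    have hd' := mul_left_cancel₀ (by norm_num) hd
    have hfu : f u = f' (ψ u) := hf.eq_of_nhds
    simp only [map_add, map_smul, add_apply, smul_apply, hd', H.ambientProduct_position hu]
    rw [hfu, H'.ambientProduct_position hψu, hB]
  ext w z
  refine (H.frobenius hu).eq_of_counit_mul fun v => ?_
  change conormal f u (ambientProduct ε f u (ambientProduct ε f u w z) v) =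
    conormal f u (ambientProduct ε f u (ambientProduct ε f' (ψ u) w z) v)
  rw [H.ambientProduct_comm hu _ v, H.ambientProduct_comm hu _ v, hT, ← hB]

end ChangeOfCoordinates

/-! ### The Frobenius structure at a point of the manifold -/

section Charts

variable {n : ℕ} {M : Type*} [TopologicalSpace M] [ChartedSpace (EuclideanSpace ℝ (Fin n)) M]
  [IsManifold (𝓡 n) ∞ M] {x : M → (Fin (n + 1) → ℝ)} {ε : ℝ}

theorem IsCentroaffineHypersurface.contDiffOn (hx : IsCentroaffineHypersurface x)
    {e : OpenPartialHomeomorph M (EuclideanSpace ℝ (Fin n))}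
    (he : e ∈ atlas (EuclideanSpace ℝ (Fin n)) M) : ContDiffOn ℝ ∞ (x ∘ e.symm) e.target := by
  rw [← contMDiffOn_iff_contDiffOn]
  exact hx.1.comp_contMDiffOn (contMDiffOn_symm_of_mem_maximalAtlas
    (IsManifold.subset_maximalAtlas he))

theorem IsCentroaffineHypersurface.frame_isInvertible (hx : IsCentroaffineHypersurface x)
    {e : OpenPartialHomeomorph M (EuclideanSpace ℝ (Fin n))}
    (he : e ∈ atlas (EuclideanSpace ℝ (Fin n)) M) {u : EuclideanSpace ℝ (Fin n)}
    (hu : u ∈ e.target) : (frame (x ∘ e.symm) u).IsInvertible := by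
  have : IsManifold (𝓡 n) 1 M := IsManifold.of_le (n := ∞) (by simp)
  have hmd := (mdifferentiable_of_mem_atlas (I := 𝓡 n) he).symm
  have hx1 : MDifferentiableAt (𝓡 n) 𝓘(ℝ, Fin (n + 1) → ℝ) x (e.symm u) :=
    hx.1.mdifferentiable (by simp) _
  -- the differentials, as maps between vector spaces instead of tangent spaces
  obtain ⟨D, S, hD, hxD, hS, hcomp⟩ : ∃ (D : EuclideanSpace ℝ (Fin n) →L[ℝ] (Fin (n + 1) → ℝ))
      (S : EuclideanSpace ℝ (Fin n) →L[ℝ] EuclideanSpace ℝ (Fin n)), Function.Injective D ∧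
      x (e.symm u) ∉ Set.range D ∧ Function.Injective S ∧
      fderiv ℝ (x ∘ e.symm) u = D.comp S := by
    refine ⟨mfderiv (𝓡 n) 𝓘(ℝ, Fin (n + 1) → ℝ) x (e.symm u), mfderiv (𝓡 n) (𝓡 n) (⇑e.symm) u,
      (hx.2 _).1, (hx.2 _).2, hmd.mfderiv_injective hu, ?_⟩
    rw [← mfderiv_eq_fderiv]
    exact mfderiv_comp u hx1 (hmd.mdifferentiableAt hu)
  have inj : Function.Injective (frame (x ∘ e.symm) u).toLinearMap := by
    rw [← LinearMap.ker_eq_bot, LinearMap.ker_eq_bot']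
    rintro ⟨X, a⟩ hX
    have h1 : D (S X) + a • x (e.symm u) = 0 := by
      rw [← hX, ← ContinuousLinearMap.comp_apply, ← hcomp]
      exact (frame_apply (x ∘ e.symm) u (X, a)).symm
    have ha : a = 0 := by
      by_contra ha
      refine hxD ⟨-a⁻¹ • S X, ?_⟩
      rw [map_smul, eq_neg_of_add_eq_zero_left h1]
      simp [ha]
    subst ha
    rw [zero_smul, add_zero, ← map_zero D] at h1
    have h2 := hD h1
    rw [← map_zero S] at h2
    simp [hS h2]
  refine ⟨(LinearEquiv.ofInjectiveOfFinrankEq (frame (x ∘ e.symm) u).toLinearMap inj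
    (by simp)).toContinuousLinearEquiv, ?_⟩
  ext <;> rfl

theorem isCanonicalOn_chart (hx : IsCentroaffineHypersurface x) (hε : ε = 1 ∨ ε = -1)
    (hconvex : MetricPosDef ε x) (hcanonical : IsCanonical ε x)
    {e : OpenPartialHomeomorph M (EuclideanSpace ℝ (Fin n))}
    (he : e ∈ atlas (EuclideanSpace ℝ (Fin n)) M) :
    IsCanonicalOn ε (x ∘ e.symm) e.target where
  isOpen := e.open_target
  sign_mul_self := by rcases hε with rfl | rfl <;> norm_num
  contDiffOn := hx.contDiffOn he
  invertible _ hu := hx.frame_isInvertible he hu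
  posDef := hconvex e he
  flat := hcanonical.1 e he
  parallel := hcanonical.2 e he

/-- The Frobenius structure at a point of the manifold, computed in the preferred chart. -/
def frobeniusAt
    (H : ∀ e ∈ atlas (EuclideanSpace ℝ (Fin n)) M, IsCanonicalOn ε (x ∘ e.symm) e.target)
    (p : M) : FrobeniusStructure ε (Fin (n + 1) → ℝ) :=
  (H _ (chart_mem_atlas _ p)).frobenius (mem_chart_target _ p)

theorem FrobeniusStructure.ext' {V : Type*} [NormedAddCommGroup V] [NormedSpace ℝ V]
    {A B : FrobeniusStructure ε V} (h1 : A.mul = B.mul) (h2 : A.one = B.one)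
    (h3 : A.counit = B.counit) : A = B := by
  cases A; cases B; congr

open Filter Topology in
/-- The Frobenius structure at `p` can be computed in every chart around `p`. -/
theorem frobeniusAt_eq
    (H : ∀ e ∈ atlas (EuclideanSpace ℝ (Fin n)) M, IsCanonicalOn ε (x ∘ e.symm) e.target)
    {e : OpenPartialHomeomorph M (EuclideanSpace ℝ (Fin n))}
    (he : e ∈ atlas (EuclideanSpace ℝ (Fin n)) M) {p : M} (hp : p ∈ e.source) :
    frobeniusAt H p = (H e he).frobenius (e.map_source hp) := by
  set c := chartAt (EuclideanSpace ℝ (Fin n)) p with hc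
  have hcmem : c ∈ atlas (EuclideanSpace ℝ (Fin n)) M := chart_mem_atlas _ p
  have hpc : p ∈ c.source := mem_chart_source _ p
  have hψs : c.symm.trans e ∈ contDiffGroupoid ∞ (𝓡 n) :=
    HasGroupoid.compatible hcmem he
  have hcd : ContDiffOn ℝ ∞ (c.symm.trans e) (c.symm.trans e).source := by
    rw [← contMDiffOn_iff_contDiffOn]
    exact contMDiffOn_of_mem_contDiffGroupoid hψs
  have hmem : c p ∈ (c.symm.trans e).source := by
    simp [hpc, hp]
  have hnhds := (c.symm.trans e).open_source.mem_nhds hmem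
  have hψ : ∀ᶠ w in 𝓝 (c p), DifferentiableAt ℝ (c.symm.trans e) w := by
    filter_upwards [(c.symm.trans e).open_source.eventually_mem hmem] with w hw
    exact (hcd.contDiffAt ((c.symm.trans e).open_source.mem_nhds hw)).differentiableAt (by simp)
  have hf : x ∘ c.symm =ᶠ[𝓝 (c p)] (x ∘ e.symm) ∘ (c.symm.trans e) := by
    filter_upwards [hnhds] with w hw
    have : c.symm w ∈ e.source := by simpa using (show w ∈ (c.symm.trans e).source from hw).2
    simp [this]
  have hval : (c.symm.trans e) (c p) = e p := by simp [hpc]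
  have h1 := conormal_eq_of_eventuallyEq_comp (H c hcmem) (H e he) (c.map_source hpc)
    (by rw [hval]; exact e.map_source hp) hψ.self_of_nhds hf
  have h2 := ambientProduct_eq_of_eventuallyEq_comp (H c hcmem) (H e he) (c.map_source hpc)
    (by rw [hval]; exact e.map_source hp) hψ hf
  rw [hval] at h1 h2
  refine FrobeniusStructure.ext' h2 ?_ h1
  change x (c.symm (c p)) = x (e.symm (e p))
  rw [c.left_inv hpc, e.left_inv hp]

open Filter Topology in
theorem eventually_equivalent_frobeniusAt
    (H : ∀ e ∈ atlas (EuclideanSpace ℝ (Fin n)) M, IsCanonicalOn ε (x ∘ e.symm) e.target)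
    (p : M) : ∀ᶠ q in 𝓝 p, (frobeniusAt H p).Equivalent (frobeniusAt H q) := by
  set c := chartAt (EuclideanSpace ℝ (Fin n)) p with hc
  have hcmem : c ∈ atlas (EuclideanSpace ℝ (Fin n)) M := chart_mem_atlas _ p
  have hpc : p ∈ c.source := mem_chart_source _ p
  have h := (c.continuousAt hpc).eventually
    ((H c hcmem).eventually_equivalent (c.map_source hpc))
  filter_upwards [h, c.open_source.mem_nhds hpc] with q ⟨hq, h1⟩ h2
  rw [frobeniusAt_eq H hcmem hpc, frobeniusAt_eq H hcmem h2]
  exact h1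

/-- The isomorphism class of the Frobenius structure is constant on connected components. -/
theorem equivalent_frobeniusAt
    (H : ∀ e ∈ atlas (EuclideanSpace ℝ (Fin n)) M, IsCanonicalOn ε (x ∘ e.symm) e.target)
    {p q : M} (hq : q ∈ connectedComponent p) :
    (frobeniusAt H p).Equivalent (frobeniusAt H q) := by
  have hclopen : IsClopen {q | (frobeniusAt H p).Equivalent (frobeniusAt H q)} := by
    constructor
    · rw [← isOpen_compl_iff, isOpen_iff_eventually]
      intro q hq
      filter_upwards [eventually_equivalent_frobeniusAt H q] with r hr h
      exact hq (h.trans hr.symm)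
    · rw [isOpen_iff_eventually]
      intro q hq
      filter_upwards [eventually_equivalent_frobeniusAt H q] with r hr
      exact hq.trans hr
  exact hclopen.connectedComponent_subset (FrobeniusStructure.Equivalent.refl _) hq

end Charts

/-! ### Models and local equivalence -/

section LocalEquivalence

open Filter Topology

variable {n : ℕ} {M : Type*} [TopologicalSpace M] [ChartedSpace (EuclideanSpace ℝ (Fin n)) M]
  {x : M → (Fin (n + 1) → ℝ)} {ε : ℝ}

/-- If `x` maps a neighbourhood of `p` into a linear image of a set `S` that meets each ray at most
once, then `x` is locally equivalent to `S`: the map `(u, s) ↦ s x(u)` is a local diffeomorphism,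
and `s x(u)` lies in the image of `S` only for `s = 1`. -/
theorem locallyEquivalentAt_of_eventually_mem {p : M}
    {e : OpenPartialHomeomorph M (EuclideanSpace ℝ (Fin n))} (hp : p ∈ e.source)
    (hf : ContDiffAt ℝ ∞ (x ∘ e.symm) (e p)) (hF : (frame (x ∘ e.symm) (e p)).IsInvertible)
    {S : Set (Fin (n + 1) → ℝ)} (G : (Fin (n + 1) → ℝ) ≃ₗ[ℝ] (Fin (n + 1) → ℝ))
    (hG : ∀ᶠ u in 𝓝 (e p), G (x (e.symm u)) ∈ S)
    (hS : ∀ y ∈ S, ∀ s : ℝ, 0 < s → s • y ∈ S → s = 1) : LocallyEquivalentAt x p S := by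
  set f := x ∘ e.symm with hf_def
  set Ψ : EuclideanSpace ℝ (Fin n) × ℝ → (Fin (n + 1) → ℝ) := fun q => q.2 • f q.1 with hΨ
  obtain ⟨A, hA⟩ := hF
  have hstrict : HasStrictFDerivAt Ψ
      (A : (EuclideanSpace ℝ (Fin n) × ℝ) →L[ℝ] (Fin (n + 1) → ℝ)) (e p, 1) := by
    have h1 : HasStrictFDerivAt (fun q : EuclideanSpace ℝ (Fin n) × ℝ => f q.1)
        ((fderiv ℝ f (e p)).comp (ContinuousLinearMap.fst ℝ _ ℝ)) (e p, 1) :=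
      HasStrictFDerivAt.comp (e p, (1 : ℝ)) (hf.hasStrictFDerivAt (by simp)) hasStrictFDerivAt_fst
    have h2 := (hasStrictFDerivAt_snd (𝕜 := ℝ) (E := EuclideanSpace ℝ (Fin n)) (F := ℝ)
      (p := (e p, 1))).smul h1
    rw [hA]
    refine HasStrictFDerivAt.congr_fderiv (f := Ψ) h2 ?_
    ext a <;> simp [frame]
  set Φ := hstrict.toOpenPartialHomeomorph Ψ
  have hΦ : ∀ q, Φ q = Ψ q := fun q => by
    rw [HasStrictFDerivAt.toOpenPartialHomeomorph_coe]
  have hsrc : ∀ᶠ q in 𝓝 (e p, (1 : ℝ)), q ∈ Φ.source ∧ q.1 ∈ e.target ∧ G (f q.1) ∈ S := by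
    refine Filter.Eventually.and (Φ.open_source.mem_nhds
      hstrict.mem_toOpenPartialHomeomorph_source) ?_
    exact continuousAt_fst.eventually (p := fun u => u ∈ e.target ∧ G (f u) ∈ S)
      (Filter.Eventually.and (e.open_target.mem_nhds (e.map_source hp)) hG)
  obtain ⟨r, hr, hball⟩ := Metric.eventually_nhds_iff_ball.1 hsrc
  set δ := min r 1 with hδ
  have hδ0 : 0 < δ := lt_min hr one_pos
  set O := Metric.ball (e p) δ ×ˢ Metric.ball (1 : ℝ) δ with hO
  have hOb : ∀ q ∈ O, q ∈ Metric.ball (e p, (1 : ℝ)) r := fun q hq => by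
    rw [hO, ball_prod_same] at hq
    exact Metric.ball_subset_ball (min_le_left _ _) hq
  have hOs : O ⊆ Φ.source := fun q hq => (hball q (hOb q hq)).1
  have hOpen : IsOpen (Φ '' O) :=
    Φ.isOpen_image_of_subset_source (Metric.isOpen_ball.prod Metric.isOpen_ball) hOs
  have hmem1 : ∀ u ∈ Metric.ball (e p) δ, (u, (1 : ℝ)) ∈ O := fun u hu =>
    ⟨hu, Metric.mem_ball_self hδ0⟩
  have hΨ1 : ∀ u, Ψ (u, 1) = f u := fun u => by simp [hΨ]
  have hWt : ∀ u ∈ Metric.ball (e p) δ, u ∈ e.target ∧ G (f u) ∈ S := fun u hu =>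
    (hball _ (hOb _ (hmem1 u hu))).2
  have hxU : x '' (e.symm '' Metric.ball (e p) δ) = f '' Metric.ball (e p) δ := by
    rw [Set.image_image]; rfl
  refine ⟨G, e.symm '' Metric.ball (e p) δ, G '' (Φ '' O), ?_, ?_, ?_, ?_, ?_⟩
  · exact e.symm.isOpen_image_of_subset_source Metric.isOpen_ball fun u hu => (hWt u hu).1
  · exact ⟨e p, Metric.mem_ball_self hδ0, e.left_inv hp⟩
  · exact G.toContinuousLinearEquiv.toHomeomorph.isOpenMap _ hOpen
  · rintro _ ⟨u, hu, rfl⟩ _ ⟨w, hw, rfl⟩ h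
    have h2 : Φ (u, 1) = Φ (w, 1) := by
      rw [hΦ, hΦ, hΨ1, hΨ1]; exact h
    have h3 := Φ.injOn (hOs (hmem1 u hu)) (hOs (hmem1 w hw)) h2
    rw [(Prod.mk.inj h3).1]
  · rw [hxU]
    ext y
    constructor
    · rintro ⟨_, ⟨u, hu, rfl⟩, rfl⟩
      exact ⟨(hWt u hu).2, f u, ⟨(u, 1), hmem1 u hu, by rw [hΦ, hΨ1]⟩, rfl⟩
    · rintro ⟨hy, _, ⟨⟨u, s⟩, hq, rfl⟩, rfl⟩
      rw [hΦ] at hy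
      have hs0 : 0 < s := by
        have h1 : |s - 1| < δ := by simpa [Real.dist_eq] using hq.2
        have h2 : δ ≤ 1 := min_le_right _ _
        linarith [(abs_lt.1 h1).1]
      have hs : s = 1 := hS _ (hWt u hq.1).2 s hs0 (by simpa [hΨ] using hy)
      subst hs
      exact ⟨f u, ⟨u, hq.1, rfl⟩, by rw [hΦ, hΨ1]⟩

/-- A set `S` is a model of a Frobenius structure if some linear isomorphism `G` maps into `S` the
zero set, near the unit, of a function `Λ` that behaves like `counit ∘ log`, i.e. whose derivative
at `y` vanishes on all products `y z` with `counit z = 0`. -/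
def FrobeniusStructure.HasModel (A : FrobeniusStructure ε (Fin (n + 1) → ℝ))
    (S : Set (Fin (n + 1) → ℝ)) : Prop :=
  (∀ y ∈ S, ∀ s : ℝ, 0 < s → s • y ∈ S → s = 1) ∧
  ∃ (G : (Fin (n + 1) → ℝ) ≃ₗ[ℝ] (Fin (n + 1) → ℝ)) (D : Set (Fin (n + 1) → ℝ))
    (Λ : (Fin (n + 1) → ℝ) → ℝ), D ∈ 𝓝 A.one ∧ Λ A.one = 0 ∧
    (∀ y ∈ D, ∃ Λ' : (Fin (n + 1) → ℝ) →L[ℝ] ℝ, HasFDerivAt Λ Λ' y ∧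
      ∀ z, A.counit z = 0 → Λ' (A.mul y z) = 0) ∧
    ∀ y ∈ D, Λ y = 0 → G y ∈ S

theorem FrobeniusStructure.HasModel.of_equivalent {A B : FrobeniusStructure ε (Fin (n + 1) → ℝ)}
    {S : Set (Fin (n + 1) → ℝ)} (hA : A.HasModel S) (h : A.Equivalent B) : B.HasModel S := by
  obtain ⟨hS, G, D, Λ, hD, h1, hΛ, hmem⟩ := hA
  obtain ⟨φ, hmul, hc⟩ := h.symm
  have hone : φ B.one = A.one := by
    have h2 := hmul B.one (φ.symm A.one)
    rw [B.one_mul, LinearEquiv.apply_symm_apply, A.mul_one] at h2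
    exact h2.symm
  have hcont : Continuous φ := φ.toContinuousLinearEquiv.continuous
  refine ⟨hS, φ.trans G, φ ⁻¹' D, Λ ∘ φ, hcont.continuousAt.preimage_mem_nhds (by rwa [hone]),
    by simp [hone, h1], fun y hy => ?_, fun y hy h0 => hmem _ hy h0⟩
  obtain ⟨Λ', hd, hz⟩ := hΛ _ hy
  refine ⟨Λ'.comp (φ.toContinuousLinearEquiv : _ →L[ℝ] _),
    HasFDerivAt.comp (f := φ.toContinuousLinearEquiv) y hd
      φ.toContinuousLinearEquiv.hasFDerivAt, fun z hz0 => ?_⟩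
  have : Λ' (φ (B.mul y z)) = 0 := by rw [hmul]; exact hz _ (by rw [hc, hz0])
  exact this

/-- A function whose derivative vanishes near a point is constant near that point. -/
theorem eventually_eq_of_eventually_hasFDerivAt_zero {E : Type*} [NormedAddCommGroup E]
    [NormedSpace ℝ E] {g : E → ℝ} {u₀ : E} (h : ∀ᶠ u in 𝓝 u₀, HasFDerivAt g (0 : E →L[ℝ] ℝ) u) :
    ∀ᶠ u in 𝓝 u₀, g u = g u₀ := by
  obtain ⟨r, hr, hball⟩ := Metric.eventually_nhds_iff_ball.1 h
  filter_upwards [Metric.ball_mem_nhds u₀ hr] with u hu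
  exact Metric.isOpen_ball.is_const_of_fderiv_eq_zero (convex_ball u₀ r).isPreconnected
    (fun w hw => (hball w hw).differentiableAt.differentiableWithinAt)
    (fun w hw => (hball w hw).fderiv) hu (Metric.mem_ball_self hr)

/-- By `IsCanonicalOn.eventually_logDeriv` the function `Λ` of a model is constant along the
hypersurface, which therefore lies in the model after the linear map `G`. -/
theorem locallyEquivalentAt_of_hasModel [IsManifold (𝓡 n) ∞ M]
    (H : ∀ e ∈ atlas (EuclideanSpace ℝ (Fin n)) M, IsCanonicalOn ε (x ∘ e.symm) e.target)
    {p : M} {S : Set (Fin (n + 1) → ℝ)} (hS : (frobeniusAt H p).HasModel S) :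
    LocallyEquivalentAt x p S := by
  obtain ⟨hray, G, D, Λ, hD, h1, hΛ, hmem⟩ := hS
  set e := chartAt (EuclideanSpace ℝ (Fin n)) p
  have He := H e (chart_mem_atlas _ p)
  have hp : p ∈ e.source := mem_chart_source _ p
  have hep : e p ∈ e.target := e.map_source hp
  have hone : (frobeniusAt H p).one = (x ∘ e.symm) (e p) := rfl
  rw [hone] at hD h1
  refine locallyEquivalentAt_of_eventually_mem hp (He.contDiffAt hep) (He.invertible _ hep) G ?_
    hray
  have hDu : ∀ᶠ u in 𝓝 (e p), (x ∘ e.symm) u ∈ D := (He.contDiffAt hep).continuousAt hD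
  have hzero : ∀ᶠ u in 𝓝 (e p), HasFDerivAt (Λ ∘ x ∘ e.symm)
      (0 : EuclideanSpace ℝ (Fin n) →L[ℝ] ℝ) u := by
    filter_upwards [hDu, He.eventually_logDeriv hep, e.open_target.mem_nhds hep] with u h2 h3 h4
    obtain ⟨Λ', hd, hz⟩ := hΛ _ h2
    have h5 := hd.comp u ((He.contDiffAt h4).differentiableAt (by simp)).hasFDerivAt
    refine h5.congr_fderiv (ContinuousLinearMap.ext fun W => ?_)
    obtain ⟨z, hz0, hW⟩ := h3 W
    change Λ' (fderiv ℝ (x ∘ e.symm) u W) = 0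
    rw [hW]
    exact hz z hz0
  filter_upwards [hDu, eventually_eq_of_eventually_hasFDerivAt_zero hzero] with u h2 h3
  refine hmem _ h2 (h3.trans h1)

end LocalEquivalence

/-! ### The three kinds of models -/

section ModelHypersurfaces

open Filter Topology Finset

variable {n : ℕ} {ε : ℝ}

theorem coord_smul (s : ℝ) (y : Fin (n + 1) → ℝ) (k : ℕ) :
    coord (s • y) k = s * coord y k := rfl

/-- Linear forms that separate points are the coordinates of a linear isomorphism. -/
theorem exists_linearEquiv_coord (c : ℕ → (Fin (n + 1) → ℝ) →ₗ[ℝ] ℝ)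
    (hc : ∀ v, (∀ k ∈ Icc 1 (n + 1), c k v = 0) → v = 0) :
    ∃ G : (Fin (n + 1) → ℝ) ≃ₗ[ℝ] (Fin (n + 1) → ℝ),
      ∀ k ∈ Icc 1 (n + 1), ∀ v, coord (G v) k = c k v := by
  set L : (Fin (n + 1) → ℝ) →ₗ[ℝ] (Fin (n + 1) → ℝ) :=
    LinearMap.pi fun i => c (i + 1) with hL
  have hLc : ∀ k ∈ Icc 1 (n + 1), ∀ v, coord (L v) k = c k v := by
    intro k hk v
    rw [mem_Icc] at hk
    have h1 : ((Fin.ofNat (n + 1) (k - 1) : Fin (n + 1)) : ℕ) + 1 = k := by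
      rw [Fin.val_ofNat, Nat.mod_eq_of_lt (by omega)]
      omega
    simp only [coord, hL, LinearMap.pi_apply, h1]
  have hinj : Function.Injective L := by
    rw [← LinearMap.ker_eq_bot, LinearMap.ker_eq_bot']
    intro v hv
    refine hc v fun k hk => ?_
    rw [← hLc k hk, hv]
    rfl
  exact ⟨LinearEquiv.ofInjectiveEndo L hinj, hLc⟩

theorem hasFDerivAt_linearForm (c : (Fin (n + 1) → ℝ) →ₗ[ℝ] ℝ) (y : Fin (n + 1) → ℝ) :
    HasFDerivAt c (LinearMap.toContinuousLinearMap c) y :=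
  (LinearMap.toContinuousLinearMap c).hasFDerivAt

theorem continuous_linearForm (c : (Fin (n + 1) → ℝ) →ₗ[ℝ] ℝ) : Continuous c :=
  (LinearMap.toContinuousLinearMap c).continuous

theorem eventually_forall_linearForm_pos {s : Finset ℕ} {c : ℕ → (Fin (n + 1) → ℝ) →ₗ[ℝ] ℝ}
    {y₀ : Fin (n + 1) → ℝ} (h : ∀ k ∈ s, 0 < c k y₀) : ∀ᶠ y in 𝓝 y₀, ∀ k ∈ s, 0 < c k y := by
  rw [Filter.eventually_all_finset]
  exact fun k hk => (continuous_linearForm (c k)).continuousAt.eventually (lt_mem_nhds (h k hk))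

theorem hasFDerivAt_sum_log (s : Finset ℕ) (α : ℕ → ℝ) {c : ℕ → (Fin (n + 1) → ℝ) →ₗ[ℝ] ℝ}
    {y : Fin (n + 1) → ℝ} (h : ∀ k ∈ s, 0 < c k y) :
    HasFDerivAt (fun y => ∑ k ∈ s, α k * Real.log (c k y))
      (∑ k ∈ s, α k • (c k y)⁻¹ • LinearMap.toContinuousLinearMap (c k)) y :=
  HasFDerivAt.fun_sum fun k hk => ((hasFDerivAt_linearForm (c k) y).log (h k hk).ne').const_mul _

theorem hasFDerivAt_div_linearForm (a b : (Fin (n + 1) → ℝ) →ₗ[ℝ] ℝ) {y : Fin (n + 1) → ℝ}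
    (hb : b y ≠ 0) :
    HasFDerivAt (fun y => a y / b y) ((b y)⁻¹ • LinearMap.toContinuousLinearMap a
      - (a y / b y ^ 2) • LinearMap.toContinuousLinearMap b) y := by
  have h := (hasFDerivAt_linearForm a y).fun_mul
    ((hasDerivAt_inv hb).comp_hasFDerivAt y (hasFDerivAt_linearForm b y))
  refine HasFDerivAt.congr_fderiv (f := fun y => a y / b y) h ?_
  ext z
  simp
  ring

theorem prod_rpow_eq_exp {s : Finset ℕ} {α a : ℕ → ℝ} (h : ∀ k ∈ s, 0 < a k) :
    ∏ k ∈ s, a k ^ α k = Real.exp (∑ k ∈ s, α k * Real.log (a k)) := by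
  rw [Real.exp_sum]
  exact prod_congr rfl fun k hk => by rw [Real.rpow_def_of_pos (h k hk), mul_comm]

theorem prod_rpow_smul {s : Finset ℕ} {α a : ℕ → ℝ} (h : ∀ k ∈ s, 0 < a k) {t : ℝ} (ht : 0 < t) :
    ∏ k ∈ s, (t * a k) ^ α k = Real.exp ((∑ k ∈ s, α k) * Real.log t) * ∏ k ∈ s, a k ^ α k := by
  rw [prod_rpow_eq_exp h, prod_rpow_eq_exp fun k hk => mul_pos ht (h k hk), ← Real.exp_add,
    Finset.sum_mul, ← Finset.sum_add_distrib]
  refine congrArg _ (Finset.sum_congr rfl fun k hk => ?_)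
  rw [Real.log_mul ht.ne' (h k hk).ne']
  ring

theorem eq_one_of_exp_mul_log {a t : ℝ} (ha : a ≠ 0) (ht : 0 < t)
    (h : Real.exp (a * Real.log t) = 1) : t = 1 := by
  rw [Real.exp_eq_one_iff, mul_eq_zero] at h
  exact Real.eq_one_of_pos_of_log_eq_zero ht (h.resolve_left ha)

/-- An algebra isomorphic to `ℝⁿ⁺¹`. -/
theorem FrobeniusStructure.hasModel_productHypersurface
    (A : FrobeniusStructure ε (Fin (n + 1) → ℝ)) (c : ℕ → (Fin (n + 1) → ℝ) →ₗ[ℝ] ℝ)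
    (hc : ∀ v, (∀ k ∈ Icc 1 (n + 1), c k v = 0) → v = 0)
    (hmul : ∀ k ∈ Icc 1 (n + 1), ∀ v w, c k (A.mul v w) = c k v * c k w)
    (hone : ∀ k ∈ Icc 1 (n + 1), c k A.one = 1) (α : ℕ → ℝ)
    (hcounit : ∀ v, A.counit v = 0 → ∑ k ∈ Icc 1 (n + 1), α k * c k v = 0)
    (hα : ∑ k ∈ Icc 1 (n + 1), α k ≠ 0) : A.HasModel (productHypersurface n α) := by
  obtain ⟨G, hG⟩ := exists_linearEquiv_coord c hc
  refine ⟨?_, G, {y | ∀ k ∈ Icc 1 (n + 1), 0 < c k y},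
    fun y => ∑ k ∈ Icc 1 (n + 1), α k * Real.log (c k y), ?_, ?_, ?_, ?_⟩
  · rintro y ⟨hy, hy1⟩ s hs ⟨-, hsy⟩
    simp only [coord_smul] at hsy
    rw [prod_rpow_smul hy hs, hy1, _root_.mul_one] at hsy
    exact eq_one_of_exp_mul_log hα hs hsy
  · exact eventually_forall_linearForm_pos fun k hk => by rw [hone k hk]; exact one_pos
  · exact sum_eq_zero fun k hk => by rw [hone k hk]; simp
  · intro y hy
    refine ⟨_, hasFDerivAt_sum_log _ α hy, fun z hz => ?_⟩
    rw [← hcounit z hz]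
    simp only [_root_.sum_apply, smul_apply, LinearMap.coe_toContinuousLinearMap', smul_eq_mul]
    refine sum_congr rfl fun k hk => ?_
    rw [hmul k hk, inv_mul_cancel_left₀ (hy k hk).ne']
  · intro y hy h0
    have hpos : ∀ k ∈ Icc 1 (n + 1), 0 < coord (G y) k := fun k hk => by
      rw [hG k hk]; exact hy k hk
    refine ⟨hpos, ?_⟩
    beta_reduce at h0
    rw [prod_rpow_eq_exp hpos, sum_congr rfl fun k hk => by rw [hG k hk y], h0, Real.exp_zero]

/-- An algebra isomorphic to `ℝⁿ⁻¹ × ℂ`, where `c (n + 1)` and `c n` are the real and imaginary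
parts of the complex component. -/
theorem FrobeniusStructure.hasModel_arctanHypersurface (hn : 1 ≤ n)
    (A : FrobeniusStructure ε (Fin (n + 1) → ℝ)) (c : ℕ → (Fin (n + 1) → ℝ) →ₗ[ℝ] ℝ)
    (hc : ∀ v, (∀ k ∈ Icc 1 (n + 1), c k v = 0) → v = 0)
    (hmul : ∀ k ∈ Icc 1 (n - 1), ∀ v w, c k (A.mul v w) = c k v * c k w)
    (hre : ∀ v w, c (n + 1) (A.mul v w) = c (n + 1) v * c (n + 1) w - c n v * c n w)
    (him : ∀ v w, c n (A.mul v w) = c (n + 1) v * c n w + c n v * c (n + 1) w)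
    (hone : ∀ k ∈ Icc 1 (n - 1), c k A.one = 1)
    (hone_re : c (n + 1) A.one = 1) (hone_im : c n A.one = 0) (α : ℕ → ℝ)
    (hcounit : ∀ v, A.counit v = 0 → ∑ k ∈ Icc 1 (n - 1), α k * c k v
      + 2 * α n * c (n + 1) v + α (n + 1) * c n v = 0)
    (hα : 2 * α n + ∑ k ∈ Icc 1 (n - 1), α k ≠ 0) : A.HasModel (arctanHypersurface n α) := by
  obtain ⟨G, hG⟩ := exists_linearEquiv_coord c hc
  have hsub : ∀ k ∈ Icc 1 (n - 1), k ∈ Icc 1 (n + 1) := fun k hk => by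
    simp only [mem_Icc] at hk ⊢; omega
  have hGn := hG n (by simp [hn])
  have hGn1 := hG (n + 1) (by simp)
  refine ⟨?_, G, {y | (∀ k ∈ Icc 1 (n - 1), 0 < c k y) ∧ 0 < c (n + 1) y},
    fun y => ∑ k ∈ Icc 1 (n - 1), α k * Real.log (c k y)
      + α n * Real.log (c n y ^ 2 + c (n + 1) y ^ 2)
      + α (n + 1) * Real.arctan (c n y / c (n + 1) y), ?_, ?_, ?_, ?_⟩
  · rintro y ⟨hy, hy0, hy1⟩ s hs ⟨-, -, hsy⟩
    simp only [coord_smul] at hsy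
    have hpos : 0 < coord y n ^ 2 + coord y (n + 1) ^ 2 := by positivity
    rw [prod_rpow_smul hy hs, mul_div_mul_left _ _ hs.ne', mul_pow, mul_pow, ← mul_add,
      Real.mul_rpow (by positivity) hpos.le, Real.rpow_def_of_pos (by positivity : 0 < s ^ 2),
      Real.log_pow] at hsy
    refine eq_one_of_exp_mul_log hα hs ?_
    rw [← hsy, add_mul, Real.exp_add]
    conv_lhs => rw [← _root_.mul_one (_ * _), ← hy1]
    push_cast
    rw [show 2 * Real.log s * α n = 2 * α n * Real.log s by ring]
    ring
  · refine Filter.Eventually.and (eventually_forall_linearForm_pos fun k hk => ?_) ?_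
    · rw [hone k hk]; exact one_pos
    · refine (continuous_linearForm (c (n + 1))).continuousAt.eventually (lt_mem_nhds ?_)
      rw [hone_re]; exact one_pos
  · beta_reduce
    rw [sum_eq_zero fun k hk => by rw [hone k hk, Real.log_one, mul_zero]]
    simp [hone_re, hone_im]
  · rintro y ⟨hy, hy0⟩
    have hpos : 0 < c n y ^ 2 + c (n + 1) y ^ 2 := by positivity
    have h1 := hasFDerivAt_linearForm (c n) y
    have h2 := hasFDerivAt_linearForm (c (n + 1)) y
    refine ⟨_, ((hasFDerivAt_sum_log _ α hy).add
      ((((h1.pow 2).add (h2.pow 2)).log hpos.ne').const_mul (α n))).add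
      ((hasFDerivAt_div_linearForm (c n) (c (n + 1)) hy0.ne').arctan.const_mul (α (n + 1))),
      fun z hz => ?_⟩
    rw [← hcounit z hz]
    simp only [add_apply, sub_apply, _root_.sum_apply, smul_apply,
      LinearMap.coe_toContinuousLinearMap', smul_eq_mul, hre, him, Pi.add_apply]
    congr 1
    · congr 1
      · refine sum_congr rfl fun k hk => ?_
        rw [hmul k hk, inv_mul_cancel_left₀ (hy k hk).ne']
      · field_simp
        ring
    · field_simp
      ring
  · rintro y ⟨hy, hy0⟩ h0
    have hpos : ∀ k ∈ Icc 1 (n - 1), 0 < coord (G y) k := fun k hk => by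
      rw [hG k (hsub k hk)]; exact hy k hk
    have hsq : 0 < c n y ^ 2 + c (n + 1) y ^ 2 := by positivity
    beta_reduce at h0
    refine ⟨hpos, by rw [hGn1]; exact hy0.ne', ?_⟩
    rw [prod_rpow_eq_exp hpos, sum_congr rfl fun k hk => by rw [hG k (hsub k hk) y], hGn, hGn1,
      Real.rpow_def_of_pos hsq, ← Real.exp_add, ← Real.exp_add, _root_.mul_comm (Real.log _), h0,
      Real.exp_zero]

/-- An algebra isomorphic to `ℝⁿ⁻ᵛ⁺¹ × B`, where the local algebra `B` has the coordinates
`c 1` (along the unit), `c 2, …, c (v - 1)` and `c (n + 1)` (along the socle). -/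
theorem FrobeniusStructure.hasModel_logHypersurface {v : ℕ} (hv2 : 2 ≤ v) (hvn : v ≤ n + 1)
    (A : FrobeniusStructure ε (Fin (n + 1) → ℝ)) (c : ℕ → (Fin (n + 1) → ℝ) →ₗ[ℝ] ℝ)
    (hc : ∀ y, (∀ k ∈ Icc 1 (n + 1), c k y = 0) → y = 0)
    (hmul1 : ∀ y z, c 1 (A.mul y z) = c 1 y * c 1 z)
    (hmul : ∀ k ∈ Icc v n, ∀ y z, c k (A.mul y z) = c k y * c k z)
    (hnil : ∀ k ∈ Icc 2 (v - 1), ∀ y z, c k (A.mul y z) = c 1 y * c k z + c k y * c 1 z)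
    (hsoc : ∀ y z, c (n + 1) (A.mul y z) = c 1 y * c (n + 1) z + c (n + 1) y * c 1 z
      + ∑ k ∈ Icc 2 (v - 1), c k y * c k z)
    (hone1 : c 1 A.one = 1) (hone : ∀ k ∈ Icc v n, c k A.one = 1)
    (hone_nil : ∀ k ∈ Icc 2 (v - 1), c k A.one = 0) (hone_soc : c (n + 1) A.one = 0) (α : ℕ → ℝ)
    (hcounit : ∀ y, A.counit y = 0 →
      c (n + 1) y + (-c 1 y + ∑ k ∈ Icc v n, α k * c k y) = 0)
    (hα : ∑ k ∈ Icc v n, α k < 1) : A.HasModel (logHypersurface n v α) := by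
  obtain ⟨G, hG⟩ := exists_linearEquiv_coord c hc
  have hsub : ∀ k ∈ Icc v n, k ∈ Icc 1 (n + 1) := fun k hk => by
    simp only [mem_Icc] at hk ⊢; omega
  have hsub2 : ∀ k ∈ Icc 2 (v - 1), k ∈ Icc 1 (n + 1) := fun k hk => by
    simp only [mem_Icc] at hk ⊢; omega
  have hG1 := hG 1 (by simp)
  have hGn1 := hG (n + 1) (by simp)
  refine ⟨?_, G, {y | 0 < c 1 y ∧ (∀ k ∈ Icc v n, 0 < c k y)},
    fun y => c (n + 1) y / c 1 y - (1 / 2) * ∑ k ∈ Icc 2 (v - 1), (c k y / c 1 y) ^ 2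
      + (-Real.log (c 1 y) + ∑ k ∈ Icc v n, α k * Real.log (c k y)), ?_, ?_, ?_, ?_⟩
  · rintro y ⟨hy1, hy, hy0⟩ s hs ⟨-, -, hsy⟩
    simp only [coord_smul] at hsy
    have hlog : ∑ k ∈ Icc v n, α k * Real.log (s * coord y k) =
        (∑ k ∈ Icc v n, α k) * Real.log s + ∑ k ∈ Icc v n, α k * Real.log (coord y k) := by
      rw [Finset.sum_mul, ← Finset.sum_add_distrib]
      refine Finset.sum_congr rfl fun k hk => ?_
      rw [Real.log_mul hs.ne' (hy k hk).ne']
      ring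
    have hsq : ∑ k ∈ Icc 2 (v - 1), (s * coord y k) ^ 2 =
        s ^ 2 * ∑ k ∈ Icc 2 (v - 1), coord y k ^ 2 := by
      rw [Finset.mul_sum]
      exact Finset.sum_congr rfl fun k _ => by ring
    rw [hlog, hsq, Real.log_mul hs.ne' hy1.ne', hy0] at hsy
    have h1 : (1 - ∑ k ∈ Icc v n, α k) * Real.log s = 0 := by
      field_simp at hsy
      have h2 : 2 * coord y 1 ^ 2 * ((1 - ∑ k ∈ Icc v n, α k) * Real.log s) = 0 := by
        linarith
      simpa [hy1.ne'] using h2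
    rcases mul_eq_zero.1 h1 with h | h
    · linarith
    · exact Real.eq_one_of_pos_of_log_eq_zero hs h
  · refine Filter.Eventually.and ?_ (eventually_forall_linearForm_pos fun k hk => ?_)
    · refine (continuous_linearForm (c 1)).continuousAt.eventually (lt_mem_nhds ?_)
      rw [hone1]; exact one_pos
    · rw [hone k hk]; exact one_pos
  · beta_reduce
    rw [sum_eq_zero fun k hk => by rw [hone_nil k hk, zero_div, zero_pow two_ne_zero],
      sum_eq_zero fun k hk => by rw [hone k hk, Real.log_one, mul_zero]]
    simp [hone1, hone_soc]
  · rintro y ⟨hy1, hy⟩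
    have h1 := hasFDerivAt_linearForm (c 1) y
    have h3 : HasFDerivAt (fun y => ∑ k ∈ Icc 2 (v - 1), (c k y / c 1 y) ^ 2) _ y :=
      HasFDerivAt.fun_sum fun k _ => (hasFDerivAt_div_linearForm (c k) (c 1) hy1.ne').pow 2
    refine ⟨_, ((hasFDerivAt_div_linearForm (c (n + 1)) (c 1) hy1.ne').sub
      (h3.const_mul (1 / 2))).add
      ((h1.log hy1.ne').neg.add (hasFDerivAt_sum_log _ α hy)), fun z hz => ?_⟩
    rw [← hcounit z hz]
    simp only [add_apply, sub_apply, neg_apply, _root_.sum_apply, smul_apply,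
      LinearMap.coe_toContinuousLinearMap', smul_eq_mul, hmul1, hsoc]
    have h4 : ∑ k ∈ Icc v n, α k * ((c k y)⁻¹ * c k (A.mul y z)) =
        ∑ k ∈ Icc v n, α k * c k z :=
      sum_congr rfl fun k hk => by rw [hmul k hk, inv_mul_cancel_left₀ (hy k hk).ne']
    have h5 : ∀ k ∈ Icc 2 (v - 1), (c 1 y)⁻¹ * c k (A.mul y z)
        - c k y / c 1 y ^ 2 * (c 1 y * c 1 z) = c k z := fun k hk => by
      rw [hnil k hk]
      field_simp
      ring
    have h6 : ∑ k ∈ Icc 2 (v - 1), 2 • (c k y / c 1 y) ^ (2 - 1) *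
        ((c 1 y)⁻¹ * c k (A.mul y z) - c k y / c 1 y ^ 2 * (c 1 y * c 1 z)) =
        2 * (c 1 y)⁻¹ * ∑ k ∈ Icc 2 (v - 1), c k y * c k z := by
      rw [Finset.mul_sum]
      refine sum_congr rfl fun k hk => ?_
      rw [h5 k hk]
      simp
      ring
    rw [h4, h6]
    field_simp
    ring
  · rintro y ⟨hy1, hy⟩ h0
    refine ⟨by rwa [hG1], fun k hk => by rw [hG k (hsub k hk)]; exact hy k hk, ?_⟩
    rw [sum_congr rfl fun k hk => by rw [hG k (hsub2 k hk) y], hG1, hGn1]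
    have h3 : ∑ k ∈ Icc v n, α k * Real.log (coord (G y) k) =
        ∑ k ∈ Icc v n, α k * Real.log (c k y) :=
      sum_congr rfl fun k hk => by rw [hG k (hsub k hk) y]
    rw [h3]
    simp only [div_pow] at h0
    rw [← Finset.sum_div] at h0
    field_simp at h0 ⊢
    linarith

end ModelHypersurfaces

/-! ### Simultaneous diagonalisation -/

section Diagonalisation

open Module.End

/-- A commutative and associative product on a Euclidean space for which multiplications are
self-adjoint is diagonal in some orthonormal basis: the multiplications commute, and a joint
eigenbasis diagonalises the product. -/
theorem exists_orthonormalBasis_mul {U : Type*} [NormedAddCommGroup U] [InnerProductSpace ℝ U]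
    [FiniteDimensional ℝ U] (m : U →ₗ[ℝ] U →ₗ[ℝ] U) (hcomm : ∀ a b, m a b = m b a)
    (hassoc : ∀ a b c, m a (m b c) = m b (m a c))
    (hself : ∀ a b c, inner ℝ (m a b) c = inner ℝ b (m a c)) :
    ∃ (r : ℕ) (v : OrthonormalBasis (Fin r) ℝ U) (c : Fin r → ℝ),
      ∀ i j, m (v i) (v j) = if i = j then c i • v i else 0 := by
  classical
  have hT : ∀ a, (m a).IsSymmetric := fun a b c => hself a b c
  have hC : Pairwise (Function.onFun Commute fun a => m a) := fun a b _ =>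
    LinearMap.ext fun c => hassoc a b c
  have hint := LinearMap.IsSymmetric.directSum_isInternal_of_pairwise_commute hT hC
  have hort := LinearMap.IsSymmetric.orthogonalFamily_iInf_eigenspaces hT
  set b := hint.collectedBasis fun γ => (stdOrthonormalBasis ℝ _).toBasis with hb
  have hbo : Orthonormal ℝ b := DirectSum.IsInternal.collectedBasis_orthonormal hort hint
    fun γ => by simp
  have : Finite (Σ γ : U → ℝ, Fin (Module.finrank ℝ
    (⨅ a, eigenspace (m a) (γ a) : Submodule ℝ U))) := Module.Finite.finite_basis b
  have : Fintype (Σ γ : U → ℝ, Fin (Module.finrank ℝ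
    (⨅ a, eigenspace (m a) (γ a) : Submodule ℝ U))) := Fintype.ofFinite _
  have heig : ∀ i a, m a (b i) = i.1 a • b i := fun i a => by
    have h1 := hint.collectedBasis_mem (fun γ => (stdOrthonormalBasis ℝ
      (⨅ a, eigenspace (m a) (γ a) : Submodule ℝ U)).toBasis) i
    exact mem_eigenspace_iff.1 ((Submodule.mem_iInf _).1 h1 a)
  set B := (b.toOrthonormalBasis hbo).reindex (Fintype.equivFin _) with hB
  have heigB : ∀ i a, ∃ μ : ℝ, m a (B i) = μ • B i := fun i a =>
    ⟨((Fintype.equivFin _).symm i).1 a, by simp [hB, heig]⟩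
  choose μ hμ using heigB
  refine ⟨_, B, fun i => μ i (B i), fun i j => ?_⟩
  split_ifs with hij
  · subst hij
    exact hμ i _
  · -- the product is a multiple of both `B i` and `B j`
    have h1 : μ j (B i) • B j = μ i (B j) • B i := by rw [← hμ, ← hμ, hcomm]
    have h2 := congrArg (fun z => inner ℝ (B j) z) h1
    simp only [inner_smul_right, B.inner_eq_ite, if_neg (Ne.symm hij)] at h2
    have h3 : μ j (B i) = 0 := by simpa using h2
    rw [hμ, h3, zero_smul]

/-- `exists_orthonormalBasis_mul` for a positive definite form `β` instead of an inner product. -/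
theorem exists_basis_mul_of_posDef {U : Type*} [AddCommGroup U] [Module ℝ U]
    [FiniteDimensional ℝ U] (m : U →ₗ[ℝ] U →ₗ[ℝ] U) (hcomm : ∀ a b, m a b = m b a)
    (hassoc : ∀ a b c, m a (m b c) = m b (m a c)) (β : U →ₗ[ℝ] U →ₗ[ℝ] ℝ)
    (hsymm : ∀ a b, β a b = β b a) (hpos : ∀ a, a ≠ 0 → 0 < β a a)
    (hself : ∀ a b c, β (m a b) c = β b (m a c)) :
    ∃ (r : ℕ) (v : Fin r → U) (c : Fin r → ℝ),
      (∀ i j, β (v i) (v j) = if i = j then 1 else 0) ∧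
      (∀ i j, m (v i) (v j) = if i = j then c i • v i else 0) ∧
      ∀ a, a = ∑ i, β (v i) a • v i := by
  let core : InnerProductSpace.Core ℝ U :=
    { inner := fun a b => β a b
      conj_inner_symm := fun a b => hsymm b a
      re_inner_nonneg := fun a => by
        rcases eq_or_ne a 0 with rfl | h
        · simp
        · exact (hpos a h).le
      add_left := fun a b c => by simp
      smul_left := fun a b r => by simp
      definite := fun a h => by
        by_contra h0
        exact (hpos a h0).ne' h }
  let _ : NormedAddCommGroup U := core.toNormedAddCommGroup
  let _ : InnerProductSpace ℝ U := InnerProductSpace.ofCore core.toCore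
  obtain ⟨r, v, c, h⟩ := exists_orthonormalBasis_mul m hcomm hassoc hself
  exact ⟨r, v, c, v.inner_eq_ite, h, fun a => (v.sum_repr' a).symm⟩

end Diagonalisation

/-! ### Elliptic algebras with nilpotent elements -/

open Finset

/-- Enumerate data `F` on a finset `t` by the members of a finset `s` of the same size. -/
theorem exists_enumeration {ι W : Type*} [Inhabited W] (t : Finset ι) (s : Finset ℕ)
    (h : t.card = s.card) (F : ι → W) :
    ∃ c : ℕ → W, (∀ k ∈ s, ∃ i ∈ t, c k = F i) ∧ (∀ i ∈ t, ∃ k ∈ s, c k = F i) ∧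
      ∀ g : W → ℝ, ∑ k ∈ s, g (c k) = ∑ i ∈ t, g (F i) := by
  classical
  set e := Finset.equivOfCardEq h
  refine ⟨fun k => if hk : k ∈ s then F (e.symm ⟨k, hk⟩) else default, fun k hk => ?_,
    fun i hi => ?_, fun g => ?_⟩
  · exact ⟨e.symm ⟨k, hk⟩, (e.symm ⟨k, hk⟩).2, by simp [hk]⟩
  · exact ⟨e ⟨i, hi⟩, (e ⟨i, hi⟩).2, by simp⟩
  · rw [← Finset.sum_coe_sort s, ← Finset.sum_coe_sort t]
    refine Fintype.sum_equiv e.symm _ _ fun k => ?_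
    simp

section Lorentzian

variable {V : Type*} [NormedAddCommGroup V] [NormedSpace ℝ V]

/-- The trace form is negative on the kernel of the counit, so two orthogonal vectors on which it
is nonnegative are linearly dependent. -/
theorem FrobeniusStructure.counit_smul_eq (A : FrobeniusStructure 1 V) {a b : V}
    (hab : A.counit (A.mul a b) = 0) (ha : 0 ≤ A.counit (A.mul a a))
    (hb : 0 ≤ A.counit (A.mul b b)) : A.counit b • a = A.counit a • b := by
  rw [← sub_eq_zero]
  by_contra h0
  have h := A.pos _ (by simp; ring) h0
  have hba : A.counit (A.mul b a) = 0 := by rw [A.mul_comm, hab]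
  simp only [map_sub, map_smul, sub_apply, smul_apply, smul_eq_mul, hab, hba] at h
  nlinarith [mul_nonneg (mul_self_nonneg (A.counit b)) ha,
    mul_nonneg (mul_self_nonneg (A.counit a)) hb]

theorem FrobeniusStructure.eq_zero_of_counit (A : FrobeniusStructure 1 V) {a : V}
    (ha : A.counit a = 0) (ha2 : 0 ≤ A.counit (A.mul a a)) : a = 0 := by
  by_contra h0
  have := A.pos a ha h0
  linarith

/-- The structure of an algebra with a nonzero element `w` of square zero. Such a `w` spans an
ideal, on which the algebra acts by a character `χ`. The remaining coordinates are `τ`, along `w`,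
and `b i`, along an orthonormal basis of the common kernel of `χ` and the counit that diagonalises
the product modulo `w`. -/
theorem FrobeniusStructure.exists_coordinates_of_mul_self_eq_zero [FiniteDimensional ℝ V]
    (A : FrobeniusStructure 1 V) {w : V} (hw0 : w ≠ 0) (hw : A.mul w w = 0) :
    ∃ (r : ℕ) (χ τ : V →ₗ[ℝ] ℝ) (b : Fin r → V →ₗ[ℝ] ℝ) (c : Fin r → ℝ),
      Module.finrank ℝ V = r + 2 ∧
      (∀ y, χ y = 0 → τ y = 0 → (∀ i, b i y = 0) → y = 0) ∧
      (∀ y z, χ (A.mul y z) = χ y * χ z) ∧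
      (∀ y z, τ (A.mul y z) = χ y * τ z + τ y * χ z - ∑ i, b i y * b i z) ∧
      (∀ i y z, b i (A.mul y z) = χ y * b i z + b i y * χ z + c i * (b i y * b i z)) ∧
      (∀ y, A.counit y = τ y + χ y) ∧
      χ A.one = 1 ∧ τ A.one = 0 ∧ ∀ i, b i A.one = 0 := by
  -- normalise `w`
  obtain ⟨w, hw, hw1⟩ : ∃ w, A.mul w w = 0 ∧ A.counit w = 1 := by
    have h1 : A.counit w ≠ 0 := fun h => hw0 (A.eq_zero_of_counit h (by simp [hw]))
    exact ⟨(A.counit w)⁻¹ • w, by simp [hw], by simp [h1]⟩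
  have hwz : ∀ z, A.mul w z = A.counit (A.mul w z) • w := fun z => by
    have h1 : A.mul w (A.mul w z) = 0 := by rw [← A.mul_assoc, hw]; simp
    have h2 : A.mul (A.mul w z) (A.mul w z) = 0 := by
      rw [A.mul_assoc, A.mul_comm z, ← A.mul_assoc, h1]; simp
    have := A.counit_smul_eq (a := w) (b := A.mul w z) (by simp [h1]) (by simp [hw]) (by simp [h2])
    rw [this, hw1, one_smul]
  set χ : V →ₗ[ℝ] ℝ := (A.counit.comp (A.mul w)).toLinearMap with hχ
  have hχw : ∀ z, A.mul w z = χ z • w := hwz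
  have hχmul : ∀ y z, χ (A.mul y z) = χ y * χ z := fun y z => by
    change A.counit (A.mul w (A.mul y z)) = _
    rw [← A.mul_assoc, hχw, map_smul, smul_apply, hχw, map_smul, map_smul, hw1]
    simp
  have hχ1 : χ A.one = 1 := by
    change A.counit (A.mul w A.one) = 1
    rw [A.mul_one, hw1]
  have hχw0 : χ w = 0 := by
    change A.counit (A.mul w w) = 0
    rw [hw, map_zero]
  -- the common kernel of `χ` and the counit, with the product modulo `w`
  set U : Submodule ℝ V := LinearMap.ker χ ⊓ LinearMap.ker A.counit.toLinearMap with hU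
  have hUχ : ∀ a : U, χ a = 0 := fun a => a.2.1
  have hUτ : ∀ a : U, A.counit (a : V) = 0 := fun a => a.2.2
  have hUw : ∀ a : U, A.mul w a = 0 := fun a => by rw [hχw, hUχ, zero_smul]
  have hmem : ∀ a b : U, A.mul a b - A.counit (A.mul a b) • w ∈ U := fun a b => by
    refine ⟨?_, ?_⟩
    · simp [hχmul, hUχ, hχw0]
    · simp [hw1]
  let m : U →ₗ[ℝ] U →ₗ[ℝ] U := LinearMap.mk₂ ℝ
    (fun a b => ⟨A.mul a b - A.counit (A.mul a b) • w, hmem a b⟩)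
    (fun a a' b => Subtype.ext (by simp; module)) (fun s a b => Subtype.ext (by simp; module))
    (fun a b b' => Subtype.ext (by simp; module)) (fun s a b => Subtype.ext (by simp; module))
  let β : U →ₗ[ℝ] U →ₗ[ℝ] ℝ := LinearMap.mk₂ ℝ (fun a b => -A.counit (A.mul a b))
    (fun a a' b => by simp; ring) (fun s a b => by simp)
    (fun a b b' => by simp; ring) (fun s a b => by simp)
  have hm : ∀ a b : U, (m a b : V) = A.mul a b - A.counit (A.mul a b) • w := fun _ _ => rfl
  have hβ : ∀ a b : U, β a b = -A.counit (A.mul a b) := fun _ _ => rfl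
  have hmm : ∀ a b c : U, (m a (m b c) : V) =
      A.mul a (A.mul b c) - A.counit (A.mul a (A.mul b c)) • w := fun a b c => by
    rw [hm, hm, map_sub, map_smul, A.mul_comm a w, hUw]
    simp
  obtain ⟨r, v, c, hv1, hv2, hv3⟩ := exists_basis_mul_of_posDef m
    (fun a b => Subtype.ext (by rw [hm, hm, A.mul_comm]))
    (fun a b c => Subtype.ext (by
      rw [hmm, hmm, ← A.mul_assoc, A.mul_comm (a : V), A.mul_assoc]))
    β (fun a b => by rw [hβ, hβ, A.mul_comm])
    (fun a ha => by
      have := A.pos a (hUτ a) (by simpa using ha)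
      rw [hβ]; linarith)
    (fun a b c => by
      have h1 : A.mul (b : V) w = 0 := by rw [A.mul_comm, hUw]
      rw [hβ, hβ, hm, hm]
      simp only [map_sub, map_smul, sub_apply, smul_apply, hUw, h1, smul_zero, sub_zero]
      rw [A.mul_comm (a : V), A.mul_assoc])
  simp only [hβ] at hv1
  have hvv : ∀ i j, A.mul (v i) (v j) = if i = j then c i • (v i : V) - w else 0 := fun i j => by
    have h1 := congrArg (Subtype.val) (hv2 i j)
    have h2 := hv1 i j
    rw [hm, sub_eq_iff_eq_add] at h1
    rw [h1]
    split_ifs at h2 ⊢ with hij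
    · rw [neg_eq_iff_eq_neg.1 h2]
      simp [sub_eq_add_neg]
    · rw [neg_eq_iff_eq_neg.1 h2]
      simp
  set τ : V →ₗ[ℝ] ℝ := A.counit.toLinearMap - χ with hτ
  set b : Fin r → V →ₗ[ℝ] ℝ := fun i => -(A.counit.comp (A.mul (v i))).toLinearMap with hb
  have hbv : ∀ i y, b i y = -A.counit (A.mul (v i) y) := fun i y => rfl
  have hτv : ∀ y, τ y = A.counit y - χ y := fun y => rfl
  have hexp : ∀ y, y = χ y • A.one + τ y • w + ∑ i, b i y • (v i : V) := fun y => by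
    have hyU : y - χ y • A.one - τ y • w ∈ U := by
      refine ⟨?_, ?_⟩
      · simp [hχ1, hχw0]
      · simp [A.counit_one, hw1, hτv]
    have h1 := congrArg Subtype.val (hv3 ⟨_, hyU⟩)
    have h2 : ∀ i, β (v i) ⟨_, hyU⟩ = b i y := fun i => by
      rw [hβ, hbv]
      simp [A.mul_one, hUτ, A.mul_comm (v i : V) w, hUw]
    simp only [h2, Submodule.coe_sum, Submodule.coe_smul] at h1
    rw [← h1]
    abel
  have hvy : ∀ i y, A.mul (v i) y = χ y • (v i : V) + (c i * b i y) • (v i : V) - b i y • w :=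
    fun i y => by
    conv_lhs => rw [hexp y]
    simp only [map_add, map_smul, map_sum, A.mul_one, A.mul_comm (v i : V) w, hUw, hvv]
    simp only [smul_zero, add_zero, smul_ite, Finset.sum_ite_eq, Finset.mem_univ, if_true]
    module
  have hb1 : ∀ i, b i A.one = 0 := fun i => by rw [hbv, A.mul_one, hUτ, neg_zero]
  have hbmul : ∀ i y z, b i (A.mul y z) = χ y * b i z + b i y * χ z + c i * (b i y * b i z) :=
    fun i y z => by
    rw [hbv, ← A.mul_assoc, hvy]
    simp only [map_add, map_sub, map_smul, add_apply, sub_apply, smul_apply, hχw, smul_eq_mul, hw1,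
      hbv]
    ring
  refine ⟨r, χ, τ, b, c, ?_, ?_, hχmul, ?_, hbmul, fun y => by rw [hτv]; ring, hχ1, ?_, hb1⟩
  · -- the coordinates define a linear isomorphism
    let L : V →ₗ[ℝ] (Fin r → ℝ) × ℝ × ℝ := (LinearMap.pi b).prod (χ.prod τ)
    have hL : Function.Bijective L := by
      constructor
      · rw [← LinearMap.ker_eq_bot, LinearMap.ker_eq_bot']
        intro y hy
        have h1 : (fun i => b i y) = 0 := congrArg Prod.fst hy
        have h2 : χ y = 0 := congrArg (fun q => q.2.1) hy
        have h3 : τ y = 0 := congrArg (fun q => q.2.2) hy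
        have h4 : ∀ i, b i y = 0 := fun i => congrFun h1 i
        rw [hexp y]
        simp [h2, h3, h4]
      · rintro ⟨β', s, t⟩
        have hbw : ∀ i, b i w = 0 := fun i => by
          rw [hbv, A.mul_comm, hUw]; simp
        have hbij : ∀ i j, b i (v j) = if i = j then 1 else 0 := fun i j => by
          rw [hbv]; exact hv1 i j
        refine ⟨s • A.one + t • w + ∑ i, β' i • (v i : V), Prod.ext (funext fun i => ?_)
          (Prod.ext ?_ ?_)⟩
        · change b i _ = _
          simp [hb1, hbw, hbij]
        · change χ _ = _
          simp [hχ1, hχw0, hUχ]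
        · change τ _ = _
          simp [hτv, hχ1, hχw0, hUχ, hUτ, A.counit_one, hw1]
    rw [(LinearEquiv.ofBijective L hL).finrank_eq]
    simp
  · intro y h1 h2 h3
    rw [hexp y]
    simp [h1, h2, h3]
  · intro y z
    have h1 : A.counit (A.mul y z) = χ y * A.counit z + τ y * χ z - ∑ i, b i y * b i z := by
      conv_lhs => rw [hexp y]
      simp only [map_add, map_smul, map_sum, add_apply, smul_apply, A.one_mul, hχw, smul_eq_mul,
        hw1, _root_.sum_apply, hbv]
      simp
      ring
    rw [hτv, h1, hχmul, hτv z]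
    ring
  · rw [hτv, hχ1, A.counit_one, sub_self]

/-- An algebra with nilpotents has a model of the third kind. -/
theorem FrobeniusStructure.exists_logHypersurface {n : ℕ}
    (A : FrobeniusStructure 1 (Fin (n + 1) → ℝ)) {w : Fin (n + 1) → ℝ} (hw0 : w ≠ 0)
    (hw : A.mul w w = 0) :
    ∃ (v : ℕ) (α : ℕ → ℝ), 2 ≤ v ∧ v ≤ n + 1 ∧ (∀ i ∈ Icc v n, 0 < α i) ∧
      ∑ i ∈ Icc v n, α i < 1 ∧ A.HasModel (logHypersurface n v α) := by
  obtain ⟨r, χ, τ, b, c, hdim, hinj, hχ, hτ, hb, hcounit, hχ1, hτ1, hb1⟩ :=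
    A.exists_coordinates_of_mul_self_eq_zero hw0 hw
  have hn : n = r + 1 := by
    rw [Module.finrank_fin_fun] at hdim; omega
  -- `c i ≠ 0` gives a further character `χ + c i • b i`, `c i = 0` a nilpotent direction
  set t₀ : Finset (Fin r) := univ.filter fun i => c i = 0 with ht₀
  set t₁ : Finset (Fin r) := univ.filter fun i => ¬ c i = 0 with ht₁
  have hcard : t₀.card + t₁.card = r := by
    rw [ht₀, ht₁, Finset.card_filter_add_card_filter_not]; simp
  set S : ℝ := ∑ i ∈ t₁, (c i ^ 2)⁻¹ with hS
  have hS0 : 0 ≤ S := Finset.sum_nonneg fun i _ => by positivity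
  -- scaling by `ρ` turns the coefficient of `log y_1` into `-1`
  set ρ : ℝ := (1 + S)⁻¹ with hρ
  have hρ0 : 0 < ρ := by positivity
  have hρS : ρ * (1 + S) = 1 := inv_mul_cancel₀ (by positivity)
  set v := t₀.card + 2 with hv
  obtain ⟨c₀, h01, h02, h03⟩ := exists_enumeration t₀ (Icc 2 (v - 1)) (by simp [hv])
    (fun i => Real.sqrt ρ • b i)
  obtain ⟨c₁, h11, h12, h13⟩ := exists_enumeration t₁ (Icc v n)
    (by rw [Nat.card_Icc]; omega) (fun i => (χ + c i • b i, ρ * (c i ^ 2)⁻¹))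
  -- the terms in `b i` remove the directions with `c i ≠ 0` from the product rule of `τ`
  set κ : (Fin (n + 1) → ℝ) →ₗ[ℝ] ℝ := ρ • (-τ - ∑ i ∈ t₁, (c i)⁻¹ • b i) with hκ
  set f : ℕ → (Fin (n + 1) → ℝ) →ₗ[ℝ] ℝ := fun k =>
    if k = 1 then χ else if k = n + 1 then κ else if k < v then c₀ k else (c₁ k).1 with hf
  have hf1 : f 1 = χ := by simp [hf]
  have hfn : f (n + 1) = κ := by
    have : n ≠ 0 := by omega
    simp [hf, this]
  have hf0 : ∀ k ∈ Icc 2 (v - 1), f k = c₀ k := fun k hk => by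
    rw [mem_Icc] at hk
    have h1 : k ≠ 1 := by omega
    have h2 : k ≠ n + 1 := by omega
    have h3 : k < v := by omega
    simp [hf, h1, h2, h3]
  have hf2 : ∀ k ∈ Icc v n, f k = (c₁ k).1 := fun k hk => by
    rw [mem_Icc] at hk
    have h1 : k ≠ 1 := by omega
    have h2 : k ≠ n + 1 := by omega
    have h3 : ¬ k < v := by omega
    simp [hf, h1, h2, h3]
  have hαsum : ∑ k ∈ Icc v n, (c₁ k).2 = ρ * S := by
    rw [h13 fun q => q.2, hS, Finset.mul_sum]
  refine ⟨v, fun k => (c₁ k).2, by omega, by omega, fun k hk => ?_, ?_, ?_⟩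
  · obtain ⟨i, hi, hki⟩ := h11 k hk
    have : c i ≠ 0 := (Finset.mem_filter.1 hi).2
    simp only [hki]
    positivity
  · rw [hαsum]; linarith
  refine A.hasModel_logHypersurface (v := v) (by omega) (by omega) f ?_ ?_ ?_ ?_ ?_ ?_ ?_ ?_ ?_ _
    ?_ ?_
  · intro y hy
    have hχ0 : χ y = 0 := by rw [← hf1]; exact hy 1 (by simp)
    have hκ0 : κ y = 0 := by rw [← hfn]; exact hy (n + 1) (by simp)
    have hb0 : ∀ i, b i y = 0 := fun i => by
      by_cases hci : c i = 0
      · obtain ⟨k, hk, hki⟩ := h02 i (by simp [ht₀, hci])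
        have h1 := hy k (by simp only [mem_Icc] at hk ⊢; omega)
        rw [hf0 k hk, hki] at h1
        simpa [(Real.sqrt_pos.2 hρ0).ne'] using h1
      · obtain ⟨k, hk, hki⟩ := h12 i (by simp [ht₁, hci])
        have h1 := hy k (by simp only [mem_Icc] at hk ⊢; omega)
        rw [hf2 k hk, hki] at h1
        simpa [hχ0, hci] using h1
    refine hinj y hχ0 ?_ hb0
    simpa [hκ, hb0, hρ0.ne'] using hκ0
  · intro y z; rw [hf1]; exact hχ y z
  · intro k hk y z
    obtain ⟨i, hi, hki⟩ := h11 k hk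
    rw [hf2 k hk, hki]
    simp only [LinearMap.add_apply, LinearMap.smul_apply, smul_eq_mul, hχ, hb]
    ring
  · intro k hk y z
    obtain ⟨i, hi, hki⟩ := h01 k hk
    have hci : c i = 0 := (Finset.mem_filter.1 hi).2
    rw [hf0 k hk, hki, hf1]
    simp only [LinearMap.smul_apply, smul_eq_mul, hb, hci]
    ring
  · intro y z
    rw [hfn, hf1]
    have h1 : ∑ k ∈ Icc 2 (v - 1), f k y * f k z = ∑ i ∈ t₀, ρ * (b i y * b i z) := by
      rw [Finset.sum_congr rfl fun k hk => by rw [hf0 k hk], h03 fun q => q y * q z]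
      refine Finset.sum_congr rfl fun i _ => ?_
      simp only [LinearMap.smul_apply, smul_eq_mul]
      calc Real.sqrt ρ * b i y * (Real.sqrt ρ * b i z)
          = (Real.sqrt ρ * Real.sqrt ρ) * (b i y * b i z) := by ring
        _ = _ := by rw [Real.mul_self_sqrt hρ0.le]
    have h2 : ∑ i, b i y * b i z = ∑ i ∈ t₀, b i y * b i z + ∑ i ∈ t₁, b i y * b i z := by
      rw [ht₀, ht₁, Finset.sum_filter_add_sum_filter_not]
    have h3 : ∑ i ∈ t₁, (c i)⁻¹ * b i (A.mul y z) = χ y * ∑ i ∈ t₁, (c i)⁻¹ * b i z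
        + (∑ i ∈ t₁, (c i)⁻¹ * b i y) * χ z + ∑ i ∈ t₁, b i y * b i z := by
      rw [Finset.mul_sum, Finset.sum_mul, ← Finset.sum_add_distrib, ← Finset.sum_add_distrib]
      refine Finset.sum_congr rfl fun i hi => ?_
      have : c i ≠ 0 := (Finset.mem_filter.1 hi).2
      rw [hb]
      field_simp
    rw [h1, ← Finset.mul_sum]
    simp only [hκ, LinearMap.smul_apply, LinearMap.sub_apply, LinearMap.neg_apply,
      LinearMap.sum_apply, smul_eq_mul, h3, hτ, h2]
    ring
  · rw [hf1, hχ1]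
  · intro k hk
    obtain ⟨i, hi, hki⟩ := h11 k hk
    rw [hf2 k hk, hki]
    simp [hχ1, hb1]
  · intro k hk
    obtain ⟨i, hi, hki⟩ := h01 k hk
    rw [hf0 k hk, hki]
    simp [hb1]
  · rw [hfn]
    simp [hκ, hτ1, hb1]
  · intro y hy
    rw [hcounit] at hy
    rw [hfn, hf1, Finset.sum_congr rfl fun k hk => by rw [hf2 k hk], h13 fun q => q.2 * q.1 y]
    have h4 : ∑ i ∈ t₁, ρ * (c i ^ 2)⁻¹ * (χ + c i • b i) y =
        ρ * S * χ y + ρ * ∑ i ∈ t₁, (c i)⁻¹ * b i y := by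
      rw [hS, Finset.mul_sum, Finset.sum_mul, Finset.mul_sum, ← Finset.sum_add_distrib]
      refine Finset.sum_congr rfl fun i hi => ?_
      have : c i ≠ 0 := (Finset.mem_filter.1 hi).2
      simp only [LinearMap.add_apply, LinearMap.smul_apply, smul_eq_mul]
      field_simp
    rw [h4]
    simp only [hκ, LinearMap.smul_apply, LinearMap.sub_apply, LinearMap.neg_apply,
      LinearMap.sum_apply, smul_eq_mul]
    have h5 : τ y = -χ y := by linarith
    rw [h5]
    linear_combination (χ y) * hρS
  · rw [hαsum]; linarith

end Lorentzian

/-! ### Reduced algebras -/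

/-- A finite-dimensional reduced commutative real algebra is a product of copies of `ℝ` and `ℂ`. -/
theorem exists_algEquiv_pi_real_prod_pi_complex (R : Type*) [CommRing R] [Algebra ℝ R]
    [Module.Finite ℝ R] [IsReduced R] :
    ∃ (ι κ : Set (MaximalSpectrum R)), Finite ι ∧ Finite κ ∧
      Nonempty (R ≃ₐ[ℝ] (ι → ℝ) × (κ → ℂ)) := by
  have : IsArtinianRing R := IsArtinianRing.of_finite ℝ R
  set ι : Set (MaximalSpectrum R) := {I | Nonempty ((R ⧸ I.asIdeal) ≃ₐ[ℝ] ℝ)}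
  have hκ : ∀ I : (ιᶜ : Set (MaximalSpectrum R)),
      Nonempty ((R ⧸ I.1.asIdeal) ≃ₐ[ℝ] ℂ) := fun I => by
    let _ : Field (R ⧸ I.1.asIdeal) := Ideal.Quotient.field _
    exact (Real.nonempty_algEquiv_or (R ⧸ I.1.asIdeal)).resolve_left I.2
  have f : ∀ I : ι, (R ⧸ I.1.asIdeal) ≃ₐ[ℝ] ℝ := fun I => I.2.some
  have g : ∀ I : (ιᶜ : Set (MaximalSpectrum R)), (R ⧸ I.1.asIdeal) ≃ₐ[ℝ] ℂ := fun I => (hκ I).some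
  refine ⟨ι, ιᶜ, inferInstance, inferInstance, ⟨AlgEquiv.ofBijective
    ((AlgHom.pi fun I => (f I).toAlgHom.comp (Ideal.Quotient.mkₐ ℝ I.1.asIdeal)).prod
      (AlgHom.pi fun I => (g I).toAlgHom.comp (Ideal.Quotient.mkₐ ℝ I.1.asIdeal))) ⟨?_, ?_⟩⟩⟩
  · intro a b hab
    refine (IsArtinianRing.equivPi R).injective (funext fun I => ?_)
    by_cases hI : I ∈ ι
    · exact (f ⟨I, hI⟩).injective (congrFun (congrArg Prod.fst hab) ⟨I, hI⟩)
    · exact (g ⟨I, hI⟩).injective (congrFun (congrArg Prod.snd hab) ⟨I, hI⟩)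
  · classical
    rintro ⟨s, t⟩
    obtain ⟨a, ha⟩ := (IsArtinianRing.equivPi R).surjective fun I =>
      if hI : I ∈ ι then (f ⟨I, hI⟩).symm (s ⟨I, hI⟩) else (g ⟨I, hI⟩).symm (t ⟨I, hI⟩)
    refine ⟨a, Prod.ext (funext fun I => ?_) (funext fun I => ?_)⟩
    · have h1 : Ideal.Quotient.mk I.1.asIdeal a = (f I).symm (s I) := by
        have := congrFun ha I.1
        rwa [dif_pos I.2] at this
      change f I (Ideal.Quotient.mk I.1.asIdeal a) = s I
      rw [h1, AlgEquiv.apply_symm_apply]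
    · have h1 : Ideal.Quotient.mk I.1.asIdeal a = (g I).symm (t I) := by
        have := congrFun ha I.1
        rwa [dif_neg I.2] at this
      change g I (Ideal.Quotient.mk I.1.asIdeal a) = t I
      rw [h1, AlgEquiv.apply_symm_apply]

namespace FrobeniusStructure

universe u

section Reduced

variable {ε : ℝ} {V : Type u} [NormedAddCommGroup V] [NormedSpace ℝ V]

/-- The commutative ring with underlying additive group `V`. -/
abbrev toCommRing (A : FrobeniusStructure ε V) : CommRing V :=
  { (inferInstance : AddCommGroup V) with
    mul := fun v w => A.mul v w
    one := A.one
    left_distrib := fun v w z => map_add _ w z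
    right_distrib := fun v w z => by
      change A.mul (v + w) z = A.mul v z + A.mul w z
      rw [map_add, add_apply]
    zero_mul := fun v => by
      change A.mul 0 v = 0
      rw [map_zero, zero_apply]
    mul_zero := fun v => map_zero (A.mul v)
    mul_assoc := A.mul_assoc
    one_mul := A.one_mul
    mul_one := A.mul_one
    mul_comm := A.mul_comm }

theorem exists_linearEquiv_of_reduced [FiniteDimensional ℝ V] (A : FrobeniusStructure ε V)
    (hA : ∀ v, A.mul v v = 0 → v = 0) :
    ∃ (ι κ : Type u) (_ : Fintype ι) (_ : Fintype κ) (Φ : V ≃ₗ[ℝ] (ι → ℝ) × (κ → ℂ)),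
      (∀ v w, Φ (A.mul v w) = Φ v * Φ w) ∧ Φ A.one = 1 := by
  let _ : CommRing V := A.toCommRing
  let _ : Algebra ℝ V := Algebra.ofModule
    (fun s v w => by
      change A.mul (s • v) w = s • A.mul v w
      rw [map_smul, smul_apply])
    (fun s v w => map_smul (A.mul v) s w)
  have : IsReduced V := by
    refine (isReduced_iff_pow_one_lt 2 one_lt_two).2 fun v hv => hA v ?_
    rw [sq] at hv
    exact hv
  have : Module.Finite ℝ V := ‹FiniteDimensional ℝ V›
  obtain ⟨ι, κ, h1, h2, ⟨Φ⟩⟩ := exists_algEquiv_pi_real_prod_pi_complex V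
  exact ⟨ι, κ, Fintype.ofFinite ι, Fintype.ofFinite κ, Φ.toLinearEquiv,
    fun v w => map_mul Φ v w, map_one Φ⟩

/-- On a hyperbolic structure the trace form is positive definite. -/
theorem counit_mul_self_pos (A : FrobeniusStructure (-1) V) {v : V} (hv : v ≠ 0) :
    0 < A.counit (A.mul v v) := by
  set X := v - A.counit v • A.one with hX
  have hX0 : A.counit X = 0 := by simp [hX, A.counit_one]
  have hvX : v = X + A.counit v • A.one := by rw [hX]; abel
  have h1 : A.counit (A.mul v v) = A.counit (A.mul X X) + A.counit v ^ 2 := by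
    conv_lhs => rw [hvX]
    simp only [map_add, map_smul, add_apply, smul_apply, A.mul_one, A.one_mul, hX0, A.counit_one,
      smul_eq_mul]
    ring
  rw [h1]
  by_cases h0 : X = 0
  · have h2 : A.counit v ≠ 0 := fun h => hv (by rw [hvX, h0, h, zero_smul, add_zero])
    rw [h0, map_zero, map_zero]
    positivity
  · have h2 := A.pos X hX0 h0
    have h3 := sq_nonneg (A.counit v)
    linarith

/-- In an elliptic structure without nilpotents the trace form has at most one nonnegative
direction among mutually annihilating elements. -/
theorem eq_zero_or_eq_zero_of_mul_eq_zero (A : FrobeniusStructure 1 V)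
    (hA : ∀ v, A.mul v v = 0 → v = 0) {a b : V} (hab : A.mul a b = 0)
    (ha : 0 ≤ A.counit (A.mul a a)) (hb : 0 ≤ A.counit (A.mul b b)) : a = 0 ∨ b = 0 := by
  by_cases hb0 : A.counit b = 0
  · exact Or.inr (A.eq_zero_of_counit hb0 hb)
  · left
    have h := A.counit_smul_eq (by rw [hab, map_zero]) ha hb
    refine hA a ((smul_eq_zero.1 ?_).resolve_left hb0)
    rw [← map_smul, h, map_smul, hab, smul_zero]

variable {ι κ : Type*} [Fintype ι] [Fintype κ] (A : FrobeniusStructure ε V)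
  (Φ : V ≃ₗ[ℝ] (ι → ℝ) × (κ → ℂ))

open scoped Classical in
/-- The `i`-th idempotent of the real factors. -/
def realIdempotent (i : ι) : V := Φ.symm (Pi.single i 1, 0)

open scoped Classical in
/-- The embedding of the `j`-th complex factor. -/
def complexEmbedding (j : κ) (z : ℂ) : V := Φ.symm (0, Pi.single j z)

theorem realIdempotent_ne_zero (i : ι) : realIdempotent Φ i ≠ 0 := by
  classical
  intro h
  rw [realIdempotent, LinearEquiv.map_eq_zero_iff] at h
  simpa using congrFun (congrArg Prod.fst h) i

theorem complexEmbedding_ne_zero (j : κ) {z : ℂ} (hz : z ≠ 0) : complexEmbedding Φ j z ≠ 0 := by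
  classical
  intro h
  rw [complexEmbedding, LinearEquiv.map_eq_zero_iff] at h
  exact hz (by simpa using congrFun (congrArg Prod.snd h) j)

theorem complexEmbedding_neg (j : κ) (z : ℂ) :
    complexEmbedding Φ j (-z) = -complexEmbedding Φ j z := by
  classical
  rw [complexEmbedding, complexEmbedding, ← map_neg, Pi.single_neg, Prod.neg_mk, neg_zero]

/-- The counit in terms of the components of an element. -/
theorem counit_eq_sum (v : V) : A.counit v =
    ∑ i, A.counit (realIdempotent Φ i) * (Φ v).1 i +
      ∑ j, (A.counit (complexEmbedding Φ j 1) * ((Φ v).2 j).re +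
        A.counit (complexEmbedding Φ j Complex.I) * ((Φ v).2 j).im) := by
  classical
  have h : v = ∑ i, (Φ v).1 i • realIdempotent Φ i + ∑ j, (((Φ v).2 j).re • complexEmbedding Φ j 1
      + ((Φ v).2 j).im • complexEmbedding Φ j Complex.I) := by
    refine Φ.injective (Prod.ext (funext fun i => ?_) (funext fun j => ?_))
    · simp [realIdempotent, complexEmbedding, Prod.fst_sum, Finset.sum_apply, Pi.single_apply]
    · simp [realIdempotent, complexEmbedding, Prod.snd_sum, Finset.sum_apply, Pi.single_apply,
        ← ite_add_zero, Complex.re_add_im]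
  conv_lhs => rw [h]
  simp only [map_add, map_sum, map_smul, smul_eq_mul, _root_.mul_comm]


section Products

variable {A Φ} (hΦ : ∀ v w, Φ (A.mul v w) = Φ v * Φ w)
include hΦ

theorem mul_realIdempotent_self (i : ι) :
    A.mul (realIdempotent Φ i) (realIdempotent Φ i) = realIdempotent Φ i := by
  classical
  refine Φ.injective ?_
  rw [hΦ]
  simp [realIdempotent, ← Pi.single_mul]

theorem mul_realIdempotent_of_ne {i i' : ι} (h : i ≠ i') :
    A.mul (realIdempotent Φ i) (realIdempotent Φ i') = 0 := by
  classical
  have h1 : (Pi.single i 1 : ι → ℝ) * Pi.single i' 1 = 0 := by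
    funext k
    by_cases hk : k = i <;> simp [hk, h]
  refine Φ.injective ?_
  rw [hΦ]
  simp [realIdempotent, h1]

theorem mul_complexEmbedding_self (j : κ) (z w : ℂ) :
    A.mul (complexEmbedding Φ j z) (complexEmbedding Φ j w) = complexEmbedding Φ j (z * w) := by
  classical
  refine Φ.injective ?_
  rw [hΦ]
  simp [complexEmbedding, ← Pi.single_mul]

theorem mul_complexEmbedding_of_ne {j j' : κ} (h : j ≠ j') (z w : ℂ) :
    A.mul (complexEmbedding Φ j z) (complexEmbedding Φ j' w) = 0 := by
  classical
  have h1 : (Pi.single j z : κ → ℂ) * Pi.single j' w = 0 := by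
    funext k
    by_cases hk : k = j <;> simp [hk, h]
  refine Φ.injective ?_
  rw [hΦ]
  simp [complexEmbedding, h1]

theorem mul_realIdempotent_complexEmbedding (i : ι) (j : κ) (z : ℂ) :
    A.mul (realIdempotent Φ i) (complexEmbedding Φ j z) = 0 := by
  classical
  refine Φ.injective ?_
  rw [hΦ]
  simp [realIdempotent, complexEmbedding]

end Products

/-- The trace form is indefinite on a complex factor, since `I² = -1`. -/
theorem exists_counit_mul_self_complexEmbedding_nonneg {A : FrobeniusStructure ε V}
    {Φ : V ≃ₗ[ℝ] (ι → ℝ) × (κ → ℂ)} (hΦ : ∀ v w, Φ (A.mul v w) = Φ v * Φ w) (s : ℝ) (j : κ) :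
    ∃ z : ℂ, z ≠ 0 ∧
      0 ≤ s * A.counit (A.mul (complexEmbedding Φ j z) (complexEmbedding Φ j z)) := by
  rcases le_total 0 (s * A.counit (complexEmbedding Φ j 1)) with h | h
  · exact ⟨1, one_ne_zero, by rwa [mul_complexEmbedding_self hΦ, _root_.mul_one]⟩
  · refine ⟨Complex.I, Complex.I_ne_zero, ?_⟩
    rw [mul_complexEmbedding_self hΦ, Complex.I_mul_I, complexEmbedding_neg, map_neg, mul_neg]
    linarith

/-- A hyperbolic structure is isomorphic to a product of copies of `ℝ`. -/
theorem isEmpty_of_hyperbolic {A : FrobeniusStructure (-1) V}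
    {Φ : V ≃ₗ[ℝ] (ι → ℝ) × (κ → ℂ)} (hΦ : ∀ v w, Φ (A.mul v w) = Φ v * Φ w) : IsEmpty κ := by
  refine ⟨fun j => ?_⟩
  obtain ⟨z, hz, h⟩ := exists_counit_mul_self_complexEmbedding_nonneg hΦ (-1) j
  have := A.counit_mul_self_pos (complexEmbedding_ne_zero Φ j hz)
  linarith

section Elliptic

variable {A : FrobeniusStructure 1 V} {Φ : V ≃ₗ[ℝ] (ι → ℝ) × (κ → ℂ)}
  (hA : ∀ v, A.mul v v = 0 → v = 0) (hΦ : ∀ v w, Φ (A.mul v w) = Φ v * Φ w)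
include hΦ

include hA

theorem subsingleton_complex_of_elliptic : Subsingleton κ := by
  refine ⟨fun j j' => ?_⟩
  by_contra hj
  obtain ⟨z, hz, h⟩ := exists_counit_mul_self_complexEmbedding_nonneg hΦ 1 j
  obtain ⟨z', hz', h'⟩ := exists_counit_mul_self_complexEmbedding_nonneg hΦ 1 j'
  rw [_root_.one_mul] at h h'
  rcases A.eq_zero_or_eq_zero_of_mul_eq_zero hA (mul_complexEmbedding_of_ne hΦ hj z z') h h'
    with h0 | h0
  · exact complexEmbedding_ne_zero Φ j hz h0
  · exact complexEmbedding_ne_zero Φ j' hz' h0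

theorem counit_realIdempotent_neg_of_complex (j : κ) (i : ι) :
    A.counit (realIdempotent Φ i) < 0 := by
  by_contra! hi
  obtain ⟨z, hz, h⟩ := exists_counit_mul_self_complexEmbedding_nonneg hΦ 1 j
  rw [_root_.one_mul] at h
  rcases A.eq_zero_or_eq_zero_of_mul_eq_zero hA (mul_realIdempotent_complexEmbedding hΦ i j z)
    (by rwa [mul_realIdempotent_self hΦ]) h with h0 | h0
  · exact realIdempotent_ne_zero Φ i h0
  · exact complexEmbedding_ne_zero Φ j hz h0

theorem counit_realIdempotent_neg_of_ne {i i' : ι} (hi : 0 < A.counit (realIdempotent Φ i))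
    (h : i' ≠ i) : A.counit (realIdempotent Φ i') < 0 := by
  by_contra! hi'
  rcases A.eq_zero_or_eq_zero_of_mul_eq_zero hA (mul_realIdempotent_of_ne hΦ h)
    (by rwa [mul_realIdempotent_self hΦ]) (by rw [mul_realIdempotent_self hΦ]; exact hi.le)
    with h0 | h0
  · exact realIdempotent_ne_zero Φ i' h0
  · exact realIdempotent_ne_zero Φ i h0

end Elliptic

end Reduced
section Classification

open Finset

variable {n : ℕ} {ι κ : Type*} [Fintype ι] [Fintype κ]

/-- The `i`-th real component, as a linear form. -/
def realComponent {V : Type*} [AddCommGroup V] [Module ℝ V] (Φ : V ≃ₗ[ℝ] (ι → ℝ) × (κ → ℂ))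
    (i : ι) : V →ₗ[ℝ] ℝ :=
  LinearMap.proj i ∘ₗ LinearMap.fst ℝ (ι → ℝ) (κ → ℂ) ∘ₗ Φ.toLinearMap

/-- The `j`-th complex component, as a linear map. -/
def complexComponent {V : Type*} [AddCommGroup V] [Module ℝ V] (Φ : V ≃ₗ[ℝ] (ι → ℝ) × (κ → ℂ))
    (j : κ) : V →ₗ[ℝ] ℂ :=
  LinearMap.proj j ∘ₗ LinearMap.snd ℝ (ι → ℝ) (κ → ℂ) ∘ₗ Φ.toLinearMap

theorem card_add_two_mul_card (Φ : (Fin (n + 1) → ℝ) ≃ₗ[ℝ] (ι → ℝ) × (κ → ℂ)) :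
    Fintype.card ι + 2 * Fintype.card κ = n + 1 := by
  have h := Φ.finrank_eq
  rw [Module.finrank_fin_fun, Module.finrank_prod, Module.finrank_fintype_fun_eq_card,
    Module.finrank_pi_fintype] at h
  simp [Complex.finrank_real_complex] at h
  omega

/-- The product hypersurface is a model of a product of copies of `ℝ`. The numbering `c` lists the
components together with their weights, scaled by `s ≠ 0`, which does not change the kernel of the
counit. -/
theorem hasModel_productHypersurface_of_components [IsEmpty κ] {ε : ℝ}
    {A : FrobeniusStructure ε (Fin (n + 1) → ℝ)} {Φ : (Fin (n + 1) → ℝ) ≃ₗ[ℝ] (ι → ℝ) × (κ → ℂ)}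
    (hΦ : ∀ v w, Φ (A.mul v w) = Φ v * Φ w) (hΦ1 : Φ A.one = 1) {s : ℝ} (hs : s ≠ 0)
    (c : ℕ → ((Fin (n + 1) → ℝ) →ₗ[ℝ] ℝ) × ℝ)
    (hc : ∀ k ∈ Icc 1 (n + 1), ∃ i,
      c k = (realComponent Φ i, s * A.counit (realIdempotent Φ i)))
    (hc' : ∀ i, ∃ k ∈ Icc 1 (n + 1), c k = (realComponent Φ i, s * A.counit (realIdempotent Φ i)))
    (hsum : ∀ g : ((Fin (n + 1) → ℝ) →ₗ[ℝ] ℝ) × ℝ → ℝ, ∑ k ∈ Icc 1 (n + 1), g (c k) =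
      ∑ i, g (realComponent Φ i, s * A.counit (realIdempotent Φ i))) :
    A.HasModel (productHypersurface n fun k => (c k).2) ∧ ∑ k ∈ Icc 1 (n + 1), (c k).2 = s := by
  have h1 : ∀ v, ∑ k ∈ Icc 1 (n + 1), (c k).2 * (c k).1 v = s * A.counit v := fun v => by
    rw [hsum fun q => q.2 * q.1 v, A.counit_eq_sum Φ v, Finset.univ_eq_empty (α := κ), sum_empty,
      add_zero, mul_sum]
    exact sum_congr rfl fun i _ => _root_.mul_assoc _ _ _
  have hone : ∀ k ∈ Icc 1 (n + 1), (c k).1 A.one = 1 := fun k hk => by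
    obtain ⟨i, hi⟩ := hc k hk
    rw [hi]
    change (Φ A.one).1 i = 1
    rw [hΦ1]
    rfl
  have h2 : ∑ k ∈ Icc 1 (n + 1), (c k).2 = s := by
    have h := h1 A.one
    rw [A.counit_one, _root_.mul_one] at h
    rw [← h]
    exact sum_congr rfl fun k hk => by rw [hone k hk, _root_.mul_one]
  refine ⟨A.hasModel_productHypersurface (fun k => (c k).1) (fun v hv => ?_) (fun k hk v w => ?_)
    hone _ (fun v hv => by rw [h1, hv, mul_zero]) (by rwa [h2]), h2⟩
  · refine Φ.map_eq_zero_iff.1 (Prod.ext (funext fun i => ?_) (Subsingleton.elim _ _))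
    obtain ⟨k, hk, hki⟩ := hc' i
    have h := hv k hk
    simp only [hki] at h
    exact h
  · obtain ⟨i, hi⟩ := hc k hk
    simp only [hi]
    change (Φ (A.mul v w)).1 i = (Φ v).1 i * (Φ w).1 i
    rw [hΦ]
    rfl

/-- All weights are positive, being values of the definite trace form on idempotents. -/
theorem exists_productHypersurface_of_hyperbolic
    (A : FrobeniusStructure (-1) (Fin (n + 1) → ℝ)) :
    ∃ α : ℕ → ℝ, (∀ i ∈ Icc 1 (n + 1), 0 < α i) ∧ A.HasModel (productHypersurface n α) := by
  obtain ⟨ι, κ, _, _, Φ, hΦ, hΦ1⟩ := A.exists_linearEquiv_of_reduced fun v hv => by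
    by_contra h0
    have := A.counit_mul_self_pos h0
    rw [hv, map_zero] at this
    exact this.false
  have := isEmpty_of_hyperbolic hΦ
  have hcard := card_add_two_mul_card Φ
  rw [Fintype.card_eq_zero (α := κ)] at hcard
  obtain ⟨c, h1, h2, h3⟩ := exists_enumeration (univ : Finset ι) (Icc 1 (n + 1))
    (by simpa using hcard) fun i => (realComponent Φ i, 1 * A.counit (realIdempotent Φ i))
  refine ⟨fun k => (c k).2, fun k hk => ?_, (hasModel_productHypersurface_of_components hΦ hΦ1
    one_ne_zero c (fun k hk => ?_) (fun i => h2 i (mem_univ i)) h3).1⟩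
  · obtain ⟨i, -, hi⟩ := h1 k hk
    have h := A.counit_mul_self_pos (realIdempotent_ne_zero Φ i)
    rw [mul_realIdempotent_self hΦ] at h
    simpa [hi] using h
  · obtain ⟨i, -, hi⟩ := h1 k hk
    exact ⟨i, hi⟩

/-- The weights sum to `1` and at most one of them is nonnegative, so exactly one is positive. The
model uses the weights with reversed signs, the exceptional one first. -/
theorem exists_productHypersurface_of_elliptic [IsEmpty κ]
    {A : FrobeniusStructure 1 (Fin (n + 1) → ℝ)} (hA : ∀ v, A.mul v v = 0 → v = 0)
    {Φ : (Fin (n + 1) → ℝ) ≃ₗ[ℝ] (ι → ℝ) × (κ → ℂ)}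
    (hΦ : ∀ v w, Φ (A.mul v w) = Φ v * Φ w) (hΦ1 : Φ A.one = 1) :
    ∃ α : ℕ → ℝ, α 1 < 0 ∧ (∀ i ∈ Icc 2 (n + 1), 0 < α i) ∧ ∑ i ∈ Icc 1 (n + 1), α i < 0 ∧
      A.HasModel (productHypersurface n α) := by
  classical
  have hcard := card_add_two_mul_card Φ
  rw [Fintype.card_eq_zero (α := κ)] at hcard
  obtain ⟨i₀, hi₀⟩ : ∃ i, 0 < A.counit (realIdempotent Φ i) := by
    by_contra! h
    have h1 := A.counit_eq_sum Φ A.one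
    rw [A.counit_one, hΦ1, Finset.univ_eq_empty (α := κ), sum_empty, add_zero] at h1
    have h2 : ∑ i, A.counit (realIdempotent Φ i) * (1 : (ι → ℝ) × (κ → ℂ)).1 i ≤ 0 :=
      sum_nonpos fun i _ => by simpa using h i
    linarith
  set F : ι → ((Fin (n + 1) → ℝ) →ₗ[ℝ] ℝ) × ℝ :=
    fun i => (realComponent Φ i, -1 * A.counit (realIdempotent Φ i)) with hF
  obtain ⟨c₀, h1, h2, h3⟩ := exists_enumeration (univ.erase i₀) (Icc 2 (n + 1))
    (by rw [card_erase_of_mem (mem_univ _), card_univ, Nat.card_Icc]; omega) F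
  set c : ℕ → ((Fin (n + 1) → ℝ) →ₗ[ℝ] ℝ) × ℝ := fun k => if k = 1 then F i₀ else c₀ k with hc
  have hc1 : c 1 = F i₀ := if_pos rfl
  have hc2 : ∀ k ∈ Icc 2 (n + 1), c k = c₀ k := fun k hk =>
    if_neg (by rw [mem_Icc] at hk; omega)
  have hIcc : Icc 1 (n + 1) = insert 1 (Icc 2 (n + 1)) := by
    ext k; simp only [mem_insert, mem_Icc]; omega
  have hreal : ∀ k ∈ Icc 1 (n + 1), ∃ i, c k = F i := fun k hk => by
    rw [hIcc, mem_insert] at hk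
    rcases hk with rfl | hk
    · exact ⟨i₀, hc1⟩
    · obtain ⟨i, -, hi⟩ := h1 k hk
      exact ⟨i, by rw [hc2 k hk, hi]⟩
  have hreal' : ∀ i, ∃ k ∈ Icc 1 (n + 1), c k = F i := fun i => by
    by_cases hi : i = i₀
    · exact ⟨1, by simp, by rw [hc1, hi]⟩
    · obtain ⟨k, hk, hki⟩ := h2 i (mem_erase.2 ⟨hi, mem_univ i⟩)
      exact ⟨k, by rw [hIcc]; exact mem_insert_of_mem hk, by rw [hc2 k hk, hki]⟩
  have hsum : ∀ g : ((Fin (n + 1) → ℝ) →ₗ[ℝ] ℝ) × ℝ → ℝ,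
      ∑ k ∈ Icc 1 (n + 1), g (c k) = ∑ i, g (F i) := fun g => by
    rw [hIcc, sum_insert (by simp), hc1, sum_congr rfl fun k hk => by rw [hc2 k hk], h3 g,
      add_sum_erase _ (fun i => g (F i)) (mem_univ i₀)]
  obtain ⟨hmodel, hα⟩ := hasModel_productHypersurface_of_components hΦ hΦ1
    (s := -1) (by norm_num) c hreal hreal' hsum
  refine ⟨fun k => (c k).2, ?_, fun k hk => ?_, by rw [hα]; norm_num, hmodel⟩
  · simp only [hc1, hF]
    linarith
  · obtain ⟨i, hi, hki⟩ := h1 k hk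
    have := counit_realIdempotent_neg_of_ne hA hΦ hi₀ (mem_erase.1 hi).1
    simp only [hc2 k hk, hki, hF]
    linarith

/-- A complex factor contains a direction on which the trace form is nonnegative, so there is only
one such factor and all real factors have negative weights. -/
theorem exists_arctanHypersurface_of_elliptic (hn : 1 ≤ n)
    {A : FrobeniusStructure 1 (Fin (n + 1) → ℝ)} (hA : ∀ v, A.mul v v = 0 → v = 0)
    {Φ : (Fin (n + 1) → ℝ) ≃ₗ[ℝ] (ι → ℝ) × (κ → ℂ)}
    (hΦ : ∀ v w, Φ (A.mul v w) = Φ v * Φ w) (hΦ1 : Φ A.one = 1) (j : κ) :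
    ∃ α : ℕ → ℝ, (∀ i ∈ Icc 1 (n - 1), α i < 0) ∧ 0 < 2 * α n + ∑ i ∈ Icc 1 (n - 1), α i ∧
      A.HasModel (arctanHypersurface n α) := by
  have := subsingleton_complex_of_elliptic hA hΦ
  have huniv : (univ : Finset κ) = {j} := by
    ext j'; simpa using Subsingleton.elim j' j
  have hcard := card_add_two_mul_card Φ
  rw [← card_univ (α := κ), huniv, card_singleton] at hcard
  set F : ι → ((Fin (n + 1) → ℝ) →ₗ[ℝ] ℝ) × ℝ :=
    fun i => (realComponent Φ i, A.counit (realIdempotent Φ i)) with hF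
  obtain ⟨c₀, h1, h2, h3⟩ := exists_enumeration (univ : Finset ι) (Icc 1 (n - 1))
    (by rw [card_univ, Nat.card_Icc]; omega) F
  set c : ℕ → ((Fin (n + 1) → ℝ) →ₗ[ℝ] ℝ) × ℝ := fun k =>
    if k = n + 1 then
      (Complex.reLm ∘ₗ complexComponent Φ j, A.counit (complexEmbedding Φ j Complex.I))
    else if k = n then
      (Complex.imLm ∘ₗ complexComponent Φ j, A.counit (complexEmbedding Φ j 1) / 2)
    else c₀ k with hc
  have hcn1 : c (n + 1) =
      (Complex.reLm ∘ₗ complexComponent Φ j, A.counit (complexEmbedding Φ j Complex.I)) :=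
    if_pos rfl
  have hcn : c n =
      (Complex.imLm ∘ₗ complexComponent Φ j, A.counit (complexEmbedding Φ j 1) / 2) := by
    simp [hc]
  have hck : ∀ k ∈ Icc 1 (n - 1), c k = c₀ k := fun k hk => by
    rw [mem_Icc] at hk
    have h4 : k ≠ n + 1 := by omega
    have h5 : k ≠ n := by omega
    simp [hc, h4, h5]
  have hre : ∀ v, (c (n + 1)).1 v = ((Φ v).2 j).re := fun v => by rw [hcn1]; rfl
  have him : ∀ v, (c n).1 v = ((Φ v).2 j).im := fun v => by rw [hcn]; rfl
  have hreal : ∀ k ∈ Icc 1 (n - 1), ∃ i, c k = F i := fun k hk => by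
    obtain ⟨i, -, hi⟩ := h1 k hk
    exact ⟨i, by rw [hck k hk, hi]⟩
  have hone : ∀ k ∈ Icc 1 (n - 1), (c k).1 A.one = 1 := fun k hk => by
    obtain ⟨i, hi⟩ := hreal k hk
    rw [hi]
    change (Φ A.one).1 i = 1
    rw [hΦ1]
    rfl
  have hcounit : ∀ v, ∑ k ∈ Icc 1 (n - 1), (c k).2 * (c k).1 v + 2 * (c n).2 * (c (n + 1)).1 v +
      (c (n + 1)).2 * (c n).1 v = A.counit v := fun v => by
    rw [sum_congr rfl fun k hk => by rw [hck k hk], h3 fun q => q.2 * q.1 v, A.counit_eq_sum Φ v,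
      huniv, sum_singleton, hre, him, hcn, hcn1]
    simp only [hF]
    change ∑ i, A.counit (realIdempotent Φ i) * (Φ v).1 i + _ + _ = _
    ring
  have hre1 : (c (n + 1)).1 A.one = 1 := by rw [hre, hΦ1]; rfl
  have him1 : (c n).1 A.one = 0 := by rw [him, hΦ1]; rfl
  have hpos : 2 * (c n).2 + ∑ k ∈ Icc 1 (n - 1), (c k).2 = 1 := by
    have h := hcounit A.one
    rw [A.counit_one, hre1, him1, sum_congr rfl fun k hk => by rw [hone k hk, _root_.mul_one]] at h
    linarith
  refine ⟨fun k => (c k).2, fun k hk => ?_, by rw [hpos]; exact one_pos,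
    A.hasModel_arctanHypersurface hn (fun k => (c k).1) (fun v hv => ?_) (fun k hk v w => ?_)
      (fun v w => ?_) (fun v w => ?_) hone hre1 him1 _ (fun v hv => by rw [hcounit, hv])
      (by rw [hpos]; exact one_ne_zero)⟩
  · obtain ⟨i, hi⟩ := hreal k hk
    simp only [hi]
    exact counit_realIdempotent_neg_of_complex hA hΦ j i
  · refine Φ.map_eq_zero_iff.1 (Prod.ext (funext fun i => ?_) (funext fun j' => ?_))
    · obtain ⟨k, hk, hki⟩ := h2 i (mem_univ i)
      have h := hv k (by simp only [mem_Icc] at hk ⊢; omega)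
      simp only [hck k hk, hki] at h
      exact h
    · rw [Subsingleton.elim j' j]
      exact Complex.ext (by rw [← hre]; exact hv _ (by simp))
        (by rw [← him]; exact hv _ (by simp [hn]))
  · obtain ⟨i, hi⟩ := hreal k hk
    simp only [hi]
    change (Φ (A.mul v w)).1 i = (Φ v).1 i * (Φ w).1 i
    rw [hΦ]
    rfl
  · simp only [hre, him, hΦ]
    exact Complex.mul_re _ _
  · simp only [hre, him, hΦ]
    exact Complex.mul_im _ _

end Classification

end FrobeniusStructure

end Centroaffine

end

theorem corollary1p1 (n : ℕ) (hn : 1 ≤ n)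
    {M : Type*} [TopologicalSpace M] [ChartedSpace (EuclideanSpace ℝ (Fin n)) M]
    [IsManifold (𝓡 n) ∞ M]
    (x : M → (Fin (n + 1) → ℝ)) (hx : Centroaffine.IsCentroaffineHypersurface x)
    (ε : ℝ) (hε : ε = 1 ∨ ε = -1) (hconvex : Centroaffine.MetricPosDef ε x)
    (hcanonical : Centroaffine.IsCanonical ε x) (p₀ : M) :
    ∃ H : Set (Fin (n + 1) → ℝ),
      ((∃ α : ℕ → ℝ,
          ((∀ i ∈ Finset.Icc 1 (n + 1), 0 < α i) ∨
            (α 1 < 0 ∧ (∀ i ∈ Finset.Icc 2 (n + 1), 0 < α i) ∧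
              ∑ i ∈ Finset.Icc 1 (n + 1), α i < 0)) ∧
          H = Centroaffine.productHypersurface n α) ∨
        (∃ α : ℕ → ℝ,
          (∀ i ∈ Finset.Icc 1 (n - 1), α i < 0) ∧
          0 < 2 * α n + ∑ i ∈ Finset.Icc 1 (n - 1), α i ∧
          H = Centroaffine.arctanHypersurface n α) ∨
        (∃ (v : ℕ) (α : ℕ → ℝ), 2 ≤ v ∧ v ≤ n + 1 ∧
          (∀ i ∈ Finset.Icc v n, 0 < α i) ∧ ∑ i ∈ Finset.Icc v n, α i < 1 ∧
          H = Centroaffine.logHypersurface n v α)) ∧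
      ∀ p ∈ connectedComponent p₀, Centroaffine.LocallyEquivalentAt x p H := by
  have hchart : ∀ e ∈ atlas (EuclideanSpace ℝ (Fin n)) M,
      Centroaffine.IsCanonicalOn ε (x ∘ e.symm) e.target :=
    fun e he => Centroaffine.isCanonicalOn_chart hx hε hconvex hcanonical he
  have hequiv : ∀ {H : Set (Fin (n + 1) → ℝ)}, (Centroaffine.frobeniusAt hchart p₀).HasModel H →
      ∀ p ∈ connectedComponent p₀, Centroaffine.LocallyEquivalentAt x p H := fun hH p hp =>
    Centroaffine.locallyEquivalentAt_of_hasModel hchart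
      (hH.of_equivalent (Centroaffine.equivalent_frobeniusAt hchart hp))
  generalize Centroaffine.frobeniusAt hchart p₀ = A at hequiv
  rcases hε with rfl | rfl
  · by_cases hA : ∀ v, A.mul v v = 0 → v = 0
    · obtain ⟨ι, κ, _, _, Φ, hΦ, hΦ1⟩ := A.exists_linearEquiv_of_reduced hA
      rcases isEmpty_or_nonempty κ with _ | ⟨⟨j⟩⟩
      · obtain ⟨α, h1, h2, h3, hH⟩ :=
          Centroaffine.FrobeniusStructure.exists_productHypersurface_of_elliptic hA hΦ hΦ1
        exact ⟨_, Or.inl ⟨α, Or.inr ⟨h1, h2, h3⟩, rfl⟩, hequiv hH⟩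
      · obtain ⟨α, h1, h2, hH⟩ :=
          Centroaffine.FrobeniusStructure.exists_arctanHypersurface_of_elliptic hn hA hΦ hΦ1 j
        exact ⟨_, Or.inr (Or.inl ⟨α, h1, h2, rfl⟩), hequiv hH⟩
    · push Not at hA
      obtain ⟨w, hw, hw0⟩ := hA
      obtain ⟨v, α, h1, h2, h3, h4, hH⟩ := A.exists_logHypersurface hw0 hw
      exact ⟨_, Or.inr (Or.inr ⟨v, α, h1, h2, h3, h4, rfl⟩), hequiv hH⟩
  · obtain ⟨α, h1, hH⟩ := A.exists_productHypersurface_of_hyperbolic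
    exact ⟨_, Or.inl ⟨α, Or.inl h1, rfl⟩, hequiv hH⟩
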